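/- For a positive integer $k$, a partition is called a $k$-core if none of its hooks has length divisible by $k$. Let $p(n)$ be the number of partitions of $n$ and $c_k(n)$ the number of $k$-core partitions of $n$. There is an absolute constant $d$ such that for every integer $n \ge 2$, every real $c > \frac{\sqrt{3/2}}{\pi}$ and every positive integer $k$ with $k \ge c\sqrt{n}\,\log n$, $$\frac{c_k(n)}{p(n)} \;\ge\; 1 - \frac{c^4\, d\, \log n}{n^{c\pi/\sqrt{6} - 1/2}} .$$ -/

import Mathlib

/-- The hook length of the cell `(i, j)` of a Young diagram: the cells of row `i` strictly to the
right of it, plus the cells of column `j` strictly below it, plus one. Only used for cells of `μ`. -/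
def YoungDiagram.hookLength (μ : YoungDiagram) (i j : ℕ) : ℕ :=
  (μ.rowLen i - (j + 1)) + (μ.colLen j - (i + 1)) + 1

/-- The Young diagram of a partition: its rows are the parts, in weakly decreasing order. -/
def Nat.Partition.youngDiagram {n : ℕ} (l : n.Partition) : YoungDiagram :=
  YoungDiagram.ofRowLens (l.parts.sort (· ≥ ·)) (Multiset.pairwise_sort l.parts (· ≥ ·)).sortedGE

/-- A partition is a `k`-core if none of its hooks has length divisible by `k`. -/
def Nat.Partition.IsCore {n : ℕ} (k : ℕ) (l : n.Partition) : Prop :=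
  ∀ i j : ℕ, (i, j) ∈ l.youngDiagram → ¬ k ∣ l.youngDiagram.hookLength i j

/-- The number of partitions of `n`. -/
noncomputable def numPartitions (n : ℕ) : ℕ := Nat.card n.Partition

/-- The number of `k`-core partitions of `n`. -/
noncomputable def numCores (k n : ℕ) : ℕ := Nat.card {l : n.Partition // l.IsCore k}

/-! The proof bounds the number of partitions of n that are not k-cores. Two facts carry it.

Combinatorial: encode a partition as a beta-set (beads on an abacus with k runners). A hook of
length divisible by k forces a bead that can slide down by k, so the non-cores number at most R(n),
the total count of removable beads over all beta-sets of weight n. Sliding a bead down turns a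
removable bead at weight m into an addable bead at weight m - k, and each set has at most k more
addable beads than removable ones. Hence R(m) ≤ R(m - k) + k p(m - k), and iterating gives p(n) -
c_k(n) ≤ k ∑_{j ≥ 1} p(n - jk) (`numPartitions_le_numCores_add`).

Analytic: p(n - k) ≤ D exp(-πk/√(6n)) p(n) with D absolute (`exists_shiftBound`). Weight each
partition of m by e^{-tm} with t = π/√(6n). The logarithm of Euler's product shows that the random
size is compound Poisson, with jumps ab at rate e^{-tab}/b. Its mean is n + O(1/t) and its standard
deviation has order t^{-3/2}, which dominates 1/t. Fourier inversion then bounds the probability of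
any size above by a multiple of t^{3/2}, and that of the size n below by another. Dividing the two
cancels the partition function and leaves the factor e^{-tk}; no asymptotic formula for p(n) is
needed.

Put x = c√n log n and τ = π/√(6n). The sum over j is geometric, so the loss is O(k e^{-τk}), which
is O(x e^{-τx}) = O(c log n / n^{cπ/√6 - 1/2}). Since c is bounded below, c is at most a constant
times c⁴. -/

open Finset

/-! ### Bead moves on the abacus and the recursion for removable beads -/

/-- The `N`-element sets of natural numbers whose sum exceeds the minimal possible one by `m`:
the sets of first column hook lengths (beta-sets) of partitions of `m` into at most `N` parts. -/
def betaSets (N m : ℕ) : Finset (Finset ℕ) :=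
  {X ∈ (range (m + ∑ i ∈ range N, i + 1)).powersetCard N | ∑ x ∈ X, x = m + ∑ i ∈ range N, i}

lemma mem_betaSets {N m : ℕ} {X : Finset ℕ} :
    X ∈ betaSets N m ↔ #X = N ∧ ∑ x ∈ X, x = m + ∑ i ∈ range N, i := by
  simp only [betaSets, mem_filter, mem_powersetCard]
  refine ⟨fun h => ⟨h.1.2, h.2⟩, fun h => ⟨⟨fun x hx => ?_, h.1⟩, h.2⟩⟩
  have := single_le_sum (f := fun x : ℕ => x) (fun _ _ => Nat.zero_le _) hx
  rw [mem_range]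
  omega

/-- The beads of `X` that can be moved down by `k`. -/
def removableBeads (k : ℕ) (X : Finset ℕ) : Finset ℕ := {x ∈ X | k ≤ x ∧ x - k ∉ X}

/-- The beads of `X` that can be moved up by `k`. -/
def addableBeads (k : ℕ) (X : Finset ℕ) : Finset ℕ := {x ∈ X | x + k ∉ X}

/-- Pairs of beads at distance k are counted equally from the lower and from the upper bead. Hence
addable and removable beads differ in number only through the beads at positions below k. -/
lemma card_addableBeads_le (k : ℕ) (X : Finset ℕ) :
    #(addableBeads k X) ≤ #(removableBeads k X) + k := by
  have h1 : #(addableBeads k X) + #{x ∈ X | x + k ∈ X} = #X := by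
    rw [addableBeads, add_comm]
    exact card_filter_add_card_filter_not _
  have h2 : #{x ∈ X | x + k ∈ X} = #{x ∈ X | k ≤ x ∧ x - k ∈ X} := by
    refine card_bij (fun x _ => x + k) ?_ ?_ ?_
    · intro x hx
      simp only [mem_filter] at hx ⊢
      exact ⟨hx.2, by omega, by simpa using hx.1⟩
    · intro x _ y _ h
      simpa using h
    · intro y hy
      simp only [mem_filter] at hy
      exact ⟨y - k, by simpa [Nat.sub_add_cancel hy.2.1] using ⟨hy.2.2, hy.1⟩, by omega⟩
  have h3 : X ⊆ removableBeads k X ∪ {x ∈ X | k ≤ x ∧ x - k ∈ X} ∪ range k := by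
    intro x hx
    simp only [removableBeads, mem_union, mem_filter, mem_range]
    by_cases h : k ≤ x <;> by_cases h' : x - k ∈ X <;> simp [hx, h, h']
    all_goals omega
  have h4 := (card_le_card h3).trans (card_union_le _ _)
  have h5 := card_union_le (removableBeads k X) {x ∈ X | k ≤ x ∧ x - k ∈ X}
  rw [card_range] at h4
  omega

lemma Fin.add_sub_le_of_strictMono {N : ℕ} {f : Fin N → ℕ} (hf : StrictMono f) {i j : Fin N}
    (h : i ≤ j) : f i + (j - i : ℕ) ≤ f j := by
  obtain ⟨j, hj⟩ := j
  induction j with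
  | zero =>
    have : i = ⟨0, hj⟩ := le_antisymm h (Fin.mk_le_of_le_val (Nat.zero_le _))
    simp [this]
  | succ j ih =>
    rcases h.eq_or_lt with rfl | h'
    · simp
    · have h1 : i ≤ ⟨j, by omega⟩ := Nat.lt_succ_iff.1 h'
      have h2 := ih (by omega) h1
      have h3 : f ⟨j, by omega⟩ < f ⟨j + 1, hj⟩ := hf (Fin.mk_lt_mk.2 (Nat.lt_succ_self j))
      have h4 : (i : ℕ) ≤ j := h1
      simp only at h2 ⊢
      omega

lemma Fin.val_le_of_strictMono {N : ℕ} {f : Fin N → ℕ} (hf : StrictMono f) (j : Fin N) :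
    (j : ℕ) ≤ f j := by
  have := Fin.add_sub_le_of_strictMono hf (i := ⟨0, j.pos⟩) (j := j)
    (Fin.mk_le_of_le_val (Nat.zero_le _))
  simp only [Nat.sub_zero] at this
  omega

lemma sum_orderEmbOfFin {N : ℕ} {X : Finset ℕ} (hX : #X = N) :
    ∑ i, X.orderEmbOfFin hX i = ∑ x ∈ X, x := by
  conv_rhs => rw [← map_orderEmbOfFin_univ X hX, sum_map]
  rfl

lemma sum_range_card_le_sum (X : Finset ℕ) : ∑ i ∈ range #X, i ≤ ∑ x ∈ X, x := by
  rw [← sum_orderEmbOfFin (X := X) rfl, ← Fin.sum_univ_eq_sum_range (fun i => i)]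
  exact sum_le_sum fun i _ => Fin.val_le_of_strictMono (X.orderEmbOfFin rfl).strictMono i

lemma moveBead_mem_betaSets {N m k x : ℕ} {X : Finset ℕ} (hX : X ∈ betaSets N m)
    (hk : 0 < k) (hx : x ∈ removableBeads k X) :
    k ≤ m ∧ insert (x - k) (X.erase x) ∈ betaSets N (m - k) ∧
      x - k ∈ addableBeads k (insert (x - k) (X.erase x)) := by
  rw [mem_betaSets] at hX
  simp only [removableBeads, mem_filter] at hx
  obtain ⟨hxX, hkx, hn⟩ := hx
  have hn' : x - k ∉ X.erase x := fun h => hn (mem_of_mem_erase h)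
  have hc : #(insert (x - k) (X.erase x)) = N := by
    rw [card_insert_of_notMem hn', card_erase_add_one hxX, hX.1]
  have hs : ∑ y ∈ insert (x - k) (X.erase x), y + k = m + ∑ i ∈ range N, i := by
    rw [sum_insert hn', ← hX.2, ← add_sum_erase _ _ hxX]
    omega
  -- The new set still has N elements, so its sum cannot fall below the minimal one; this is what
  -- forces k ≤ m.
  have hle := sum_range_card_le_sum (insert (x - k) (X.erase x))
  rw [hc] at hle
  refine ⟨by omega, mem_betaSets.2 ⟨hc, by omega⟩, ?_⟩
  simp only [addableBeads, mem_filter, mem_insert, mem_erase, true_or, true_and, not_or, not_and]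
  omega

/-- Sliding a bead down by k is injective on pairs (set, bead): remembering the landing position x -
k makes the move reversible. -/
lemma sum_card_removableBeads_le (N m k : ℕ) (hk : 0 < k) :
    ∑ X ∈ betaSets N m, #(removableBeads k X) ≤
      ∑ X ∈ betaSets N (m - k), #(addableBeads k X) := by
  rw [← card_sigma, ← card_sigma]
  refine card_le_card_of_injOn (fun p => ⟨insert (p.2 - k) (p.1.erase p.2), p.2 - k⟩) ?_ ?_
  · rintro ⟨X, x⟩ h
    simp only [coe_sigma, Set.mem_sigma_iff, mem_coe] at h ⊢
    exact (moveBead_mem_betaSets h.1 hk h.2).2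
  · rintro ⟨X, x⟩ h ⟨Y, y⟩ h' he
    simp only [coe_sigma, Set.mem_sigma_iff, mem_coe, removableBeads, mem_filter] at h h'
    simp only [Sigma.mk.injEq, heq_eq_eq] at he
    obtain ⟨he1, he2⟩ := he
    obtain rfl : x = y := by omega
    have hx : x - k ∉ X.erase x := fun hh => h.2.2.2 (mem_of_mem_erase hh)
    have hy : x - k ∉ Y.erase x := fun hh => h'.2.2.2 (mem_of_mem_erase hh)
    have : X.erase x = Y.erase x := by
      rw [← erase_insert hx, he1, erase_insert hy]
    have : X = Y := by rw [← insert_erase h.2.1, this, insert_erase h'.2.1]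
    rw [this]

lemma sum_card_removableBeads_le_sum_card (N k : ℕ) (hk : 0 < k) (m : ℕ) :
    ∑ X ∈ betaSets N m, #(removableBeads k X) ≤
      k * ∑ j ∈ range (m / k), #(betaSets N (m - (j + 1) * k)) := by
  induction m using Nat.strong_induction_on with
  | _ m ih =>
    rcases lt_or_ge m k with h | h
    · rw [sum_eq_zero]
      · exact Nat.zero_le _
      · intro X hX
        rw [card_eq_zero, eq_empty_iff_forall_notMem]
        exact fun x hx => absurd (moveBead_mem_betaSets hX hk hx).1 (by omega)
    · have hdiv : m / k = (m - k) / k + 1 := by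
        rw [Nat.div_eq_sub_div hk h]
      calc _ ≤ ∑ X ∈ betaSets N (m - k), #(addableBeads k X) :=
            sum_card_removableBeads_le N m k hk
        _ ≤ ∑ X ∈ betaSets N (m - k), (#(removableBeads k X) + k) :=
            sum_le_sum fun X _ => card_addableBeads_le k X
        _ ≤ k * ∑ j ∈ range ((m - k) / k), #(betaSets N (m - k - (j + 1) * k)) +
              k * #(betaSets N (m - k)) := by
            rw [sum_add_distrib, sum_const, smul_eq_mul, mul_comm #_ k]
            exact Nat.add_le_add_right (ih (m - k) (by omega)) _
        _ = _ := by
            rw [hdiv, ← mul_add, sum_range_succ']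
            congr 3
            · funext j
              rw [Nat.sub_sub, show k + (j + 1) * k = (j + 1 + 1) * k by ring]
            · simp

/-! ### Beta-sets inject into partitions -/

/-- The multiset of excesses `xᵢ - i` of the elements `x₀ < x₁ < ⋯` of `X`. -/
noncomputable def betaExcess (X : Finset ℕ) : Multiset ℕ :=
  (univ : Finset (Fin #X)).val.map fun i => X.orderEmbOfFin rfl i - i

lemma sum_betaExcess {N m : ℕ} {X : Finset ℕ} (hX : X ∈ betaSets N m) :
    (betaExcess X).sum = m := by
  obtain ⟨rfl, h⟩ := mem_betaSets.1 hX
  have h1 : (betaExcess X).sum = ∑ i : Fin #X, (X.orderEmbOfFin rfl i - (i : ℕ)) := rfl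
  have h2 : ∑ i : Fin #X, (X.orderEmbOfFin rfl i - i) + ∑ i : Fin #X, (i : ℕ) =
      ∑ i : Fin #X, X.orderEmbOfFin rfl i := by
    rw [← sum_add_distrib]
    exact sum_congr rfl fun i _ =>
      Nat.sub_add_cancel (Fin.val_le_of_strictMono (X.orderEmbOfFin rfl).strictMono i)
  rw [sum_orderEmbOfFin, h, Fin.sum_univ_eq_sum_range (fun i => i)] at h2
  omega

lemma card_betaExcess (X : Finset ℕ) : (betaExcess X).card = #X := by
  simp [betaExcess]

/-- Listed in increasing order of the elements, the excesses are weakly increasing. So the multiset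
determines the list, and adding i back to its i-th entry recovers the set. -/
lemma eq_of_betaExcess_eq {X Y : Finset ℕ} (h : betaExcess X = betaExcess Y) : X = Y := by
  have hc : #X = #Y := by rw [← card_betaExcess, h, card_betaExcess]
  have key : ∀ (N : ℕ) (Z : Finset ℕ) (hZ : #Z = N), ∃ l : List ℕ, l.SortedLE ∧
      (l : Multiset ℕ) = betaExcess Z ∧ l = List.ofFn fun i => Z.orderEmbOfFin hZ i - i := by
    rintro N Z rfl
    refine ⟨_, ?_, ?_, rfl⟩
    · rw [List.sortedLE_ofFn_iff]
      intro i j hij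
      have := Fin.add_sub_le_of_strictMono (Z.orderEmbOfFin rfl).strictMono hij
      have h2 := Fin.val_le_of_strictMono (Z.orderEmbOfFin rfl).strictMono i
      have h3 : (i : ℕ) ≤ j := hij
      simp only
      omega
    · rw [betaExcess, List.ofFn_eq_map]
      rfl
  obtain ⟨l, hl, hlX, hl'⟩ := key #Y X hc
  obtain ⟨l₂, hl₂, hlY, hl₂'⟩ := key #Y Y rfl
  have hperm : l.Perm l₂ := Multiset.coe_eq_coe.1 (by rw [hlX, hlY, h])
  have hll : l = l₂ := hperm.eq_of_sortedLE hl hl₂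
  rw [hl', hl₂'] at hll
  have hf := List.ofFn_injective hll
  have : ∀ i, X.orderEmbOfFin hc i = Y.orderEmbOfFin rfl i := by
    intro i
    have h1 := congrFun hf i
    have h2 := Fin.val_le_of_strictMono (X.orderEmbOfFin hc).strictMono i
    have h3 := Fin.val_le_of_strictMono (Y.orderEmbOfFin rfl).strictMono i
    omega
  calc X = image (X.orderEmbOfFin hc) univ := (image_orderEmbOfFin_univ X hc).symm
    _ = image (Y.orderEmbOfFin rfl) univ := image_congr fun i _ => this i
    _ = Y := image_orderEmbOfFin_univ Y rfl

/-- Needed because `Nat.Partition.ofSums` discards zero parts; knowing the cardinality restores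
them. -/
lemma Multiset.eq_of_filter_ne_zero_eq {s t : Multiset ℕ} (hc : s.card = t.card)
    (h : s.filter (· ≠ 0) = t.filter (· ≠ 0)) : s = t := by
  have h0 : ∀ u : Multiset ℕ, u.filter (· ≠ 0) + Multiset.replicate (u.count 0) 0 = u := by
    intro u
    rw [← Multiset.filter_eq', add_comm]
    exact Multiset.filter_add_not (· = 0) u
  have h1 := congrArg Multiset.card (h0 s)
  have h2 := congrArg Multiset.card (h0 t)
  rw [Multiset.card_add, Multiset.card_replicate] at h1 h2
  rw [← h0 s, ← h0 t, h]
  congr 2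
  rw [h] at h1
  omega

lemma card_betaSets_le (N m : ℕ) : #(betaSets N m) ≤ numPartitions m := by
  rw [numPartitions, Nat.card_eq_fintype_card, ← card_univ, ← card_attach]
  refine card_le_card_of_injOn
    (fun X => Nat.Partition.ofSums m (betaExcess X.1) (sum_betaExcess X.2)) (by simp) ?_
  intro X _ Y _ h
  have h' : (betaExcess X.1).filter (· ≠ 0) = (betaExcess Y.1).filter (· ≠ 0) :=
    congrArg Nat.Partition.parts h
  refine Subtype.ext (eq_of_betaExcess_eq (Multiset.eq_of_filter_ne_zero_eq ?_ h'))
  rw [card_betaExcess, card_betaExcess, (mem_betaSets.1 X.2).1, (mem_betaSets.1 Y.2).1]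

/-! ### The beta-set of a partition, and hooks as bead moves -/

namespace Nat.Partition

variable {n : ℕ}

/-- The beta-set of a partition of `n`, padded with zeros to `n` parts. -/
noncomputable def betaSet (l : n.Partition) : Finset ℕ :=
  (range n).image fun i => l.youngDiagram.rowLen i + (n - 1 - i)

lemma mem_youngDiagram (l : n.Partition) {i j : ℕ} :
    (i, j) ∈ l.youngDiagram ↔ j < (l.parts.sort (· ≥ ·)).getD i 0 := by
  rw [youngDiagram, YoungDiagram.mem_ofRowLens]
  by_cases h : i < (l.parts.sort (· ≥ ·)).length
  · rw [List.getD_eq_getElem _ _ h]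
    exact ⟨fun h => h.2, fun h' => ⟨h, h'⟩⟩
  · rw [List.getD_eq_default _ _ (not_lt.1 h)]
    exact ⟨fun h' => absurd h'.1 h, fun h' => absurd h' (Nat.not_lt_zero _)⟩

lemma rowLen_youngDiagram (l : n.Partition) (i : ℕ) :
    l.youngDiagram.rowLen i = (l.parts.sort (· ≥ ·)).getD i 0 := by
  refine eq_of_forall_lt_iff fun j => ?_
  rw [← mem_youngDiagram, YoungDiagram.mem_iff_lt_rowLen]

lemma card_parts_le (l : n.Partition) : l.parts.card ≤ n := by
  have := Multiset.card_nsmul_le_sum (s := l.parts) (a := 1) fun x hx => l.parts_pos hx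
  simpa [l.parts_sum] using this

lemma map_rowLen_range (l : n.Partition) :
    (List.range n).map l.youngDiagram.rowLen =
      l.parts.sort (· ≥ ·) ++ List.replicate (n - l.parts.card) 0 := by
  have hc := l.card_parts_le
  refine List.ext_getElem (by simp; omega) fun i h1 h2 => ?_
  rw [List.getElem_map, List.getElem_range, rowLen_youngDiagram, List.getElem_append]
  split_ifs with h
  · rw [List.getD_eq_getElem _ _ h]
  · rw [List.getD_eq_default _ _ (not_lt.1 h), List.getElem_replicate]

lemma map_rowLen_filter (l : n.Partition) :
    ((range n).val.map l.youngDiagram.rowLen).filter (· ≠ 0) = l.parts := by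
  have h1 : (range n).val.map l.youngDiagram.rowLen =
      l.parts + Multiset.replicate (n - l.parts.card) 0 := by
    have := congrArg (fun L : List ℕ => (L : Multiset ℕ)) l.map_rowLen_range
    rw [← Multiset.coe_add, Multiset.sort_eq, Multiset.coe_replicate] at this
    exact this
  rw [h1, Multiset.filter_add, Multiset.filter_eq_self.2 fun x hx => (l.parts_pos hx).ne',
    Multiset.filter_eq_nil.2 fun x hx => by simpa using Multiset.eq_of_mem_replicate hx, add_zero]

lemma sum_rowLen (l : n.Partition) : ∑ i ∈ range n, l.youngDiagram.rowLen i = n := by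
  have h1 : ∑ i ∈ range n, l.youngDiagram.rowLen i =
      ((List.range n).map l.youngDiagram.rowLen).sum := rfl
  rw [h1, map_rowLen_range, List.sum_append, ← Multiset.sum_coe, Multiset.sort_eq, l.parts_sum]
  simp

lemma rowLen_eq_zero (l : n.Partition) {i : ℕ} (hi : n ≤ i) : l.youngDiagram.rowLen i = 0 := by
  rw [rowLen_youngDiagram, List.getD_eq_default]
  rw [Multiset.length_sort]
  exact l.card_parts_le.trans hi

lemma strictMono_rowLen_rev (l : n.Partition) :
    StrictMono fun i : Fin n => l.youngDiagram.rowLen (Fin.rev i) + i := by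
  intro i j hij
  have := l.youngDiagram.rowLen_anti (Fin.rev j) (Fin.rev i) (Fin.rev_le_rev.2 hij.le)
  have h : (i : ℕ) < j := hij
  simp only
  omega

lemma coe_betaSet (l : n.Partition) :
    (l.betaSet : Set ℕ) = Set.range fun i : Fin n => l.youngDiagram.rowLen (Fin.rev i) + i := by
  ext x
  simp only [betaSet, coe_image, coe_range, Set.mem_image, Set.mem_Iio, Set.mem_range]
  constructor
  · rintro ⟨i, hi, rfl⟩
    exact ⟨Fin.rev ⟨i, hi⟩, by rw [Fin.rev_rev, Fin.val_rev]; simp only; omega⟩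
  · rintro ⟨i, rfl⟩
    exact ⟨Fin.rev i, Fin.is_lt _, by rw [Fin.val_rev]; omega⟩

lemma betaSet_mem_betaSets (l : n.Partition) : l.betaSet ∈ betaSets n n := by
  have hinj : Set.InjOn (fun i => l.youngDiagram.rowLen i + (n - 1 - i)) (range n) := by
    intro i hi j hj h
    simp only [coe_range, Set.mem_Iio] at hi hj h
    rcases lt_trichotomy i j with hij | hij | hij
    · have := l.youngDiagram.rowLen_anti i j hij.le
      omega
    · exact hij
    · have := l.youngDiagram.rowLen_anti j i hij.le
      omega
  refine mem_betaSets.2 ⟨?_, ?_⟩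
  · rw [betaSet, Finset.card_image_of_injOn hinj, card_range]
  · rw [betaSet, sum_image hinj, sum_add_distrib, sum_rowLen, sum_range_reflect (fun i => i)]

lemma betaSet_injective : Function.Injective (betaSet (n := n)) := by
  intro l l' h
  have h1 := congrArg (fun X : Finset ℕ => (X : Set ℕ)) h
  simp only [coe_betaSet] at h1
  have h2 := (l.strictMono_rowLen_rev.range_inj l'.strictMono_rowLen_rev).1 h1
  refine Nat.Partition.ext ?_
  rw [← l.map_rowLen_filter, ← l'.map_rowLen_filter]
  congr 1
  refine Multiset.map_congr rfl fun i hi => ?_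
  have hi' : i < n := by simpa using hi
  have := congrFun h2 (Fin.rev ⟨i, hi'⟩)
  simpa using this

/-- Going down the runner x, x - k, …, x - jk from an occupied position to a vacant one, some bead
must sit just above a gap. -/
lemma exists_removableBeads_of_dvd {X : Finset ℕ} {k x : ℕ} (hx : x ∈ X) (j : ℕ)
    (hjk : j * k ≤ x) (h : x - j * k ∉ X) : (removableBeads k X).Nonempty := by
  induction j generalizing x with
  | zero => simp [hx] at h
  | succ j ih =>
    have h1 : k + j * k ≤ x := by linarith [Nat.succ_mul j k]
    by_cases hxk : x - k ∈ X
    · refine ih hxk (by omega) ?_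
      rwa [Nat.sub_sub, show k + j * k = (j + 1) * k by ring]
    · exact ⟨x, by simp [removableBeads, hx, hxk]; omega⟩

lemma removableBeads_betaSet_nonempty {k : ℕ} {l : n.Partition} (hl : ¬ l.IsCore k) :
    (removableBeads k l.betaSet).Nonempty := by
  simp only [IsCore, not_forall, not_not] at hl
  obtain ⟨i, j, hij, q, hq⟩ := hl
  have hrow := YoungDiagram.mem_iff_lt_rowLen.1 hij
  have hcol := YoungDiagram.mem_iff_lt_colLen.1 hij
  have hcn : l.youngDiagram.colLen j ≤ n := by
    by_contra! hlt
    have := YoungDiagram.mem_iff_lt_rowLen.1 (YoungDiagram.mem_iff_lt_colLen.2 hlt)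
    rw [l.rowLen_eq_zero le_rfl] at this
    omega
  rw [YoungDiagram.hookLength, mul_comm] at hq
  refine exists_removableBeads_of_dvd (x := l.youngDiagram.rowLen i + (n - 1 - i))
    (mem_image_of_mem _ (mem_range.2 (by omega))) q (by omega) fun hmem => ?_
  obtain ⟨i', hi', h⟩ := mem_image.1 hmem
  rw [mem_range] at hi'
  -- The vacant position is n + j - colLen j. Rows i' < colLen j have length above j, so their beads
  -- lie above it; the other rows have length at most j, so theirs lie below it.
  have hiff : j < l.youngDiagram.rowLen i' ↔ i' < l.youngDiagram.colLen j := by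
    rw [← YoungDiagram.mem_iff_lt_rowLen, YoungDiagram.mem_iff_lt_colLen]
  omega

end Nat.Partition

/-- Removing rim hooks of length `k` bounds the number of partitions that are not `k`-cores. -/
lemma numPartitions_le_numCores_add (n k : ℕ) (hk : 0 < k) :
    numPartitions n ≤
      numCores k n + k * ∑ j ∈ range (n / k), numPartitions (n - (j + 1) * k) := by
  classical
  have h1 : #{l : n.Partition | ¬ l.IsCore k} ≤
      ∑ X ∈ betaSets n n, #(removableBeads k X) := by
    calc _ ≤ #{X ∈ betaSets n n | (removableBeads k X).Nonempty} :=
          card_le_card_of_injOn Nat.Partition.betaSet (fun l hl => by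
            simp only [coe_filter, mem_univ, true_and, Set.mem_ofPred_eq] at hl ⊢
            exact ⟨l.betaSet_mem_betaSets, l.removableBeads_betaSet_nonempty hl⟩)
            Nat.Partition.betaSet_injective.injOn
      _ ≤ _ := by
          rw [card_filter]
          refine sum_le_sum fun X _ => ?_
          split_ifs with h
          · exact h.card_pos
          · exact Nat.zero_le _
  have h2 : numPartitions n = numCores k n + #{l : n.Partition | ¬ l.IsCore k} := by
    rw [numPartitions, numCores, Nat.card_eq_fintype_card, Nat.card_eq_fintype_card,
      Fintype.card_subtype, card_filter_add_card_filter_not, card_univ]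
  rw [h2]
  refine Nat.add_le_add_left (h1.trans ((sum_card_removableBeads_le_sum_card n k hk n).trans ?_)) _
  exact Nat.mul_le_mul_left _ (sum_le_sum fun j _ => card_betaSets_le _ _)

/-! ### Euler's product as an analytic identity in the unit disc -/

section GeneratingFunction

open PowerSeries Filter Topology
open scoped PowerSeries.WithPiTopology

/-- The number of partitions of `m` into parts at most `M`, as a coefficient of a finite product of
geometric series. -/
noncomputable def boundedPartCoeff (M m : ℕ) : ℕ :=
  coeff m (∏ i ∈ range M, ∑' j : ℕ, (X ^ ((i + 1) * j) : PowerSeries ℕ))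

lemma coeff_tsum_X_pow (i m : ℕ) :
    coeff m (∑' j : ℕ, (X ^ ((i + 1) * j) : PowerSeries ℕ)) = if i + 1 ∣ m then 1 else 0 := by
  have hs : Summable fun j : ℕ => (X ^ ((i + 1) * j) : PowerSeries ℕ) := by
    simp_rw [pow_mul]
    exact WithPiTopology.summable_pow_of_constantCoeff_eq_zero (by simp)
  rw [hs.map_tsum _ (WithPiTopology.continuous_coeff _ _)]
  simp_rw [coeff_X_pow]
  split_ifs with h
  · obtain ⟨c, rfl⟩ := h
    rw [tsum_eq_single c]
    · simp
    · intro b hb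
      rw [if_neg]
      intro h
      exact hb (Nat.eq_of_mul_eq_mul_left (Nat.succ_pos i) h).symm
  · convert! tsum_zero with j
    rw [if_neg]
    exact fun h' => h ⟨j, h'⟩

lemma boundedPartCoeff_succ (M m : ℕ) :
    boundedPartCoeff (M + 1) m =
      ∑ p ∈ antidiagonal m, boundedPartCoeff M p.1 * if M + 1 ∣ p.2 then 1 else 0 := by
  simp only [boundedPartCoeff, prod_range_succ, coeff_mul, coeff_tsum_X_pow]

lemma boundedPartCoeff_mono (m : ℕ) : Monotone fun M => boundedPartCoeff M m := by
  refine monotone_nat_of_le_succ fun M => ?_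
  rw [boundedPartCoeff_succ]
  have := single_le_sum (f := fun p : ℕ × ℕ => boundedPartCoeff M p.1 * if M + 1 ∣ p.2 then 1 else 0)
    (fun _ _ => Nat.zero_le _) (show (m, 0) ∈ antidiagonal m by simp)
  simpa using this

lemma eventually_boundedPartCoeff_eq (m : ℕ) :
    ∀ᶠ M in atTop, boundedPartCoeff M m = numPartitions m := by
  have h := (Nat.Partition.hasProd_powerSeriesMk_card_restricted ℕ fun _ => True).tendsto_prod_nat
  rw [WithPiTopology.tendsto_iff_coeff_tendsto] at h
  have h' := h m
  simp only [if_true, coeff_mk, Nat.Partition.restricted] at h'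
  -- Coefficients live in the discrete space ℕ, so convergence of the formal product means that each
  -- is eventually constant.
  rw [nhds_discrete, tendsto_pure] at h'
  filter_upwards [h'] with M hM
  rw [boundedPartCoeff, hM, numPartitions, Nat.card_eq_fintype_card]
  simp

/-- This domination, with the eventual equality, allows passage from finite products to the full
series. -/
lemma boundedPartCoeff_le (M m : ℕ) : boundedPartCoeff M m ≤ numPartitions m := by
  obtain ⟨M', h1, h2⟩ := ((eventually_boundedPartCoeff_eq m).and (eventually_ge_atTop M)).exists
  rw [← h1]
  exact boundedPartCoeff_mono m h2

lemma hasSum_geometric_dvd {z : ℂ} (hz : ‖z‖ < 1) (i : ℕ) :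
    HasSum (fun m : ℕ => ((if i + 1 ∣ m then 1 else 0 : ℕ) : ℂ) * z ^ m) (1 - z ^ (i + 1))⁻¹ := by
  have h1 : HasSum (fun j : ℕ => (z ^ (i + 1)) ^ j) (1 - z ^ (i + 1))⁻¹ := by
    refine hasSum_geometric_of_norm_lt_one ?_
    rw [norm_pow]
    exact pow_lt_one₀ (norm_nonneg _) hz (Nat.succ_ne_zero i)
  have hinj : Function.Injective fun j : ℕ => (i + 1) * j :=
    fun a b h => Nat.eq_of_mul_eq_mul_left (Nat.succ_pos i) h
  refine (hinj.hasSum_iff ?_).1 ?_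
  · intro m hm
    rw [if_neg]
    · simp
    · rintro ⟨c, rfl⟩
      exact hm ⟨c, rfl⟩
  · convert! h1 using 1
    funext j
    simp [pow_mul]

lemma summable_norm_geometric_dvd {z : ℂ} (hz : ‖z‖ < 1) (i : ℕ) :
    Summable fun m : ℕ => ‖((if i + 1 ∣ m then 1 else 0 : ℕ) : ℂ) * z ^ m‖ := by
  refine Summable.of_nonneg_of_le (fun _ => norm_nonneg _) (fun m => ?_)
    (summable_geometric_of_lt_one (norm_nonneg z) hz)
  rw [norm_mul, norm_pow]
  split_ifs <;> simp

lemma boundedPartCoeff_tsum {z : ℂ} (hz : ‖z‖ < 1) (M : ℕ) :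
    (Summable fun m : ℕ => ‖(boundedPartCoeff M m : ℂ) * z ^ m‖) ∧
      ∑' m : ℕ, (boundedPartCoeff M m : ℂ) * z ^ m = ∏ i ∈ range M, (1 - z ^ (i + 1))⁻¹ := by
  induction M with
  | zero =>
    have h : ∀ m : ℕ, (boundedPartCoeff 0 m : ℂ) * z ^ m = if m = 0 then 1 else 0 := by
      intro m
      rw [boundedPartCoeff, range_zero, prod_empty, coeff_one]
      split_ifs with h <;> simp [h]
    simp_rw [h]
    refine ⟨summable_of_ne_finset_zero (s := {0}) fun m hm => ?_, by simp⟩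
    rw [if_neg (by simpa using hm), norm_zero]
  | succ M ih =>
    have h : ∀ m : ℕ, (boundedPartCoeff (M + 1) m : ℂ) * z ^ m = ∑ p ∈ antidiagonal m,
        ((boundedPartCoeff M p.1 : ℂ) * z ^ p.1) *
          (((if M + 1 ∣ p.2 then 1 else 0 : ℕ) : ℂ) * z ^ p.2) := by
      intro m
      rw [boundedPartCoeff_succ, Nat.cast_sum, sum_mul]
      refine sum_congr rfl fun p hp => ?_
      rw [← mem_antidiagonal.1 hp, pow_add, Nat.cast_mul]
      ring
    rw [tsum_congr h]
    refine ⟨(summable_norm_sum_mul_antidiagonal_of_summable_norm ih.1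
      (summable_norm_geometric_dvd hz M)).congr fun m => by rw [h m], ?_⟩
    rw [← tsum_mul_tsum_eq_tsum_sum_antidiagonal_of_summable_norm ih.1
      (summable_norm_geometric_dvd hz M), ih.2, (hasSum_geometric_dvd hz M).tsum_eq,
      prod_range_succ]

/-- The terms of `-∑ₐ log (1 - z ^ a)`. -/
noncomputable def logTerm (z : ℂ) (p : ℕ × ℕ) : ℂ := z ^ ((p.1 + 1) * (p.2 + 1)) / (p.2 + 1)

lemma summable_pow_mul_succ {r : ℝ} (h0 : 0 ≤ r) (h1 : r < 1) :
    Summable fun p : ℕ × ℕ => r ^ ((p.1 + 1) * (p.2 + 1)) := by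
  have hg := summable_geometric_of_lt_one h0 h1
  refine Summable.of_nonneg_of_le (fun _ => by positivity) (fun p => ?_)
    (hg.mul_of_nonneg hg (fun _ => by positivity) (fun _ => by positivity))
  rw [← pow_add]
  exact pow_le_pow_of_le_one h0 h1.le (by nlinarith)

lemma summable_logTerm {z : ℂ} (hz : ‖z‖ < 1) : Summable (logTerm z) := by
  refine Summable.of_norm_bounded (summable_pow_mul_succ (norm_nonneg z) hz) fun p => ?_
  rw [logTerm, norm_div, norm_pow]
  refine div_le_self (by positivity) ?_
  have : ((p.2 : ℂ) + 1) = ((p.2 + 1 : ℕ) : ℂ) := by push_cast; rfl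
  rw [this, Complex.norm_natCast]
  exact_mod_cast Nat.succ_pos _

lemma exp_tsum_logTerm {z : ℂ} (hz : ‖z‖ < 1) (a : ℕ) :
    Complex.exp (∑' b, logTerm z (a, b)) = (1 - z ^ (a + 1))⁻¹ := by
  have hz' : ‖z ^ (a + 1)‖ < 1 := by
    rw [norm_pow]
    exact pow_lt_one₀ (norm_nonneg _) hz (Nat.succ_ne_zero a)
  have h := Complex.hasSum_taylorSeries_neg_log hz'
  have h2 := (hasSum_nat_add_iff' 1).2 h
  have h3 : ∑' b, logTerm z (a, b) = -Complex.log (1 - z ^ (a + 1)) := by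
    refine HasSum.tsum_eq ?_
    convert! h2 using 1
    · funext b
      simp only [logTerm, pow_mul]
      push_cast
      rfl
    · simp
  rw [h3, Complex.exp_neg, Complex.exp_log]
  intro h0
  rw [sub_eq_zero] at h0
  rw [← h0, norm_one] at hz'
  exact lt_irrefl _ hz'

lemma tendsto_prod_inv_one_sub_pow {z : ℂ} (hz : ‖z‖ < 1) :
    Tendsto (fun M => ∏ i ∈ range M, (1 - z ^ (i + 1))⁻¹) atTop
      (𝓝 (Complex.exp (∑' p, logTerm z p))) := by
  have h := (summable_logTerm hz).prod.hasSum.tendsto_sum_nat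
  rw [← (summable_logTerm hz).tsum_prod] at h
  refine ((Complex.continuous_exp.tendsto _).comp h).congr fun M => ?_
  simp only [Function.comp_apply, Complex.exp_sum, exp_tsum_logTerm hz]

/-- Each finite partial sum is a limit of partial sums of the truncated series, which are bounded by
the finite products; these converge. -/
lemma summable_numPartitions_mul_pow {r : ℝ} (h0 : 0 ≤ r) (h1 : r < 1) :
    Summable fun m => (numPartitions m : ℝ) * r ^ m := by
  have hz : ‖(r : ℂ)‖ < 1 := by rwa [Complex.norm_real, Real.norm_of_nonneg h0]
  refine summable_of_sum_le (c := ‖Complex.exp (∑' p, logTerm r p)‖) (fun _ => by positivity)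
    fun s => ?_
  have hl : Tendsto (fun M => ∑ m ∈ s, (boundedPartCoeff M m : ℝ) * r ^ m) atTop
      (𝓝 (∑ m ∈ s, (numPartitions m : ℝ) * r ^ m)) := by
    refine tendsto_finsetSum _ fun m _ => Tendsto.mul_const _ ?_
    refine tendsto_const_nhds.congr' ?_
    filter_upwards [eventually_boundedPartCoeff_eq m] with M hM
    rw [hM]
  refine le_of_tendsto_of_tendsto' hl (tendsto_prod_inv_one_sub_pow hz).norm fun M => ?_
  obtain ⟨hs, ht⟩ := boundedPartCoeff_tsum hz M
  have hnorm : ∀ m, ‖(boundedPartCoeff M m : ℂ) * (r : ℂ) ^ m‖ = boundedPartCoeff M m * r ^ m := by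
    intro m
    rw [norm_mul, norm_pow, Complex.norm_real, Real.norm_of_nonneg h0, Complex.norm_natCast]
  simp only [hnorm] at hs
  have hcast : ∑' m : ℕ, (boundedPartCoeff M m : ℂ) * (r : ℂ) ^ m =
      ((∑' m : ℕ, (boundedPartCoeff M m : ℝ) * r ^ m : ℝ) : ℂ) := by
    rw [Complex.ofReal_tsum]
    push_cast
    rfl
  rw [← ht, hcast, Complex.norm_real]
  exact (hs.sum_le_tsum s fun _ _ => by positivity).trans (le_abs_self _)

/-- Euler's product for the partition generating function, in logarithmic form. -/
lemma hasSum_numPartitions_mul_pow {z : ℂ} (hz : ‖z‖ < 1) :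
    HasSum (fun m => (numPartitions m : ℂ) * z ^ m) (Complex.exp (∑' p, logTerm z p)) := by
  have hs := summable_numPartitions_mul_pow (norm_nonneg z) hz
  have hsum : Summable fun m => (numPartitions m : ℂ) * z ^ m := by
    refine Summable.of_norm_bounded hs fun m => ?_
    rw [norm_mul, norm_pow, Complex.norm_natCast]
  have hlim : Tendsto (fun M => ∑' m : ℕ, (boundedPartCoeff M m : ℂ) * z ^ m) atTop
      (𝓝 (∑' m : ℕ, (numPartitions m : ℂ) * z ^ m)) := by
    refine tendsto_tsum_of_dominated_convergence hs (fun m => ?_) (Eventually.of_forall fun M m => ?_)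
    · refine tendsto_const_nhds.congr' ?_
      filter_upwards [eventually_boundedPartCoeff_eq m] with M hM
      rw [hM]
    · rw [norm_mul, norm_pow, Complex.norm_natCast]
      gcongr
      exact boundedPartCoeff_le M m
  simp only [(boundedPartCoeff_tsum hz _).2] at hlim
  rw [tendsto_nhds_unique (tendsto_prod_inv_one_sub_pow hz) hlim]
  exact hsum.hasSum

end GeneratingFunction

/-! ### Mean, variance and third moment of the Boltzmann model -/

section Moments

open Filter Topology

lemma Real.sinh_le_self_mul_cosh {x : ℝ} (hx : 0 ≤ x) : Real.sinh x ≤ x * Real.cosh x := by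
  have hd : ∀ y : ℝ, HasDerivAt (fun y => y * Real.cosh y - Real.sinh y)
      (1 * Real.cosh y + y * Real.sinh y - Real.cosh y) y := fun y =>
    ((hasDerivAt_id y).mul (Real.hasDerivAt_cosh y)).sub (Real.hasDerivAt_sinh y)
  have hm : MonotoneOn (fun y => y * Real.cosh y - Real.sinh y) (Set.Ici 0) := by
    refine monotoneOn_of_deriv_nonneg (convex_Ici 0)
      (fun y _ => (hd y).continuousAt.continuousWithinAt)
      (fun y _ => (hd y).differentiableAt.differentiableWithinAt) fun y hy => ?_
    rw [interior_Ici] at hy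
    have hy' : 0 < y := hy
    have := mul_nonneg hy'.le (Real.sinh_nonneg_iff.2 hy'.le)
    rw [(hd y).deriv]
    linarith
  have := hm (Set.mem_Ici.2 le_rfl) (Set.mem_Ici.2 hx) hx
  simp only [Real.sinh_zero] at this
  linarith

lemma exp_neg_div_one_sub_sq (y : ℝ) :
    Real.exp (-y) / (1 - Real.exp (-y)) ^ 2 = 1 / (2 * Real.sinh (y / 2)) ^ 2 := by
  have h1 : Real.exp (-y) = Real.exp (-(y / 2)) ^ 2 := by
    rw [← Real.exp_nat_mul]; congr 1; push_cast; ring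
  have h2 : Real.exp (y / 2) * Real.exp (-(y / 2)) = 1 := by
    rw [← Real.exp_add]; simp
  have h3 : 1 - Real.exp (-y) = Real.exp (-(y / 2)) * (2 * Real.sinh (y / 2)) := by
    rw [Real.sinh_eq, h1]; linear_combination -h2
  rw [h3, h1, mul_pow]
  have : Real.exp (-(y / 2)) ^ 2 ≠ 0 := (pow_pos (Real.exp_pos _) 2).ne'
  rw [div_mul_eq_div_div, div_self this]

lemma exp_neg_div_one_sub_sq_le {y : ℝ} (hy : 0 < y) :
    Real.exp (-y) / (1 - Real.exp (-y)) ^ 2 ≤ 1 / y ^ 2 := by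
  rw [exp_neg_div_one_sub_sq]
  have := Real.self_le_sinh_iff.2 (half_pos hy).le
  gcongr
  linarith

/-- From sinh x ≤ x cosh x ≤ x e^{x²/2} the denominator is at most y² e^{y²/4}; then use e^{-u} ≥ 1
- u. -/
lemma le_exp_neg_div_one_sub_sq {y : ℝ} (hy : 0 < y) :
    1 / y ^ 2 - 1 / 4 ≤ Real.exp (-y) / (1 - Real.exp (-y)) ^ 2 := by
  rw [exp_neg_div_one_sub_sq]
  have h0 : 0 < Real.sinh (y / 2) := Real.sinh_pos_iff.2 (half_pos hy)
  have h1 : Real.sinh (y / 2) ≤ y / 2 * Real.exp ((y / 2) ^ 2 / 2) :=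
    (Real.sinh_le_self_mul_cosh (half_pos hy).le).trans
      (mul_le_mul_of_nonneg_left (Real.cosh_le_exp_half_sq _) (half_pos hy).le)
  have h2 : (2 * Real.sinh (y / 2)) ^ 2 ≤ y ^ 2 * Real.exp (y ^ 2 / 4) := by
    have : y ^ 2 * Real.exp (y ^ 2 / 4) = (2 * (y / 2 * Real.exp ((y / 2) ^ 2 / 2))) ^ 2 := by
      rw [mul_pow, mul_pow, ← Real.exp_nat_mul]
      push_cast
      rw [show 2 * ((y / 2) ^ 2 / 2) = y ^ 2 / 4 by ring]
      ring
    rw [this]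
    gcongr
  calc 1 / y ^ 2 - 1 / 4 = (-(y ^ 2 / 4) + 1) / y ^ 2 := by field_simp; ring
    _ ≤ Real.exp (-(y ^ 2 / 4)) / y ^ 2 := by
        gcongr
        exact Real.add_one_le_exp _
    _ = 1 / (y ^ 2 * Real.exp (y ^ 2 / 4)) := by rw [Real.exp_neg]; field_simp
    _ ≤ _ := by gcongr

/-- The size of the jump attached to the pair `(a, b)`. -/
def jumpSize (p : ℕ × ℕ) : ℝ := (p.1 + 1) * (p.2 + 1)

/-- The rate of the jump attached to the pair `(a, b)`, at inverse temperature `t`. -/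
noncomputable def jumpRate (t : ℝ) (p : ℕ × ℕ) : ℝ := Real.exp (-(t * jumpSize p)) / (p.2 + 1)

lemma one_le_jumpSize (p : ℕ × ℕ) : 1 ≤ jumpSize p := by
  rw [jumpSize]
  have h1 : (0 : ℝ) ≤ p.1 := Nat.cast_nonneg _
  have h2 : (0 : ℝ) ≤ p.2 := Nat.cast_nonneg _
  nlinarith

lemma jumpRate_nonneg (t : ℝ) (p : ℕ × ℕ) : 0 ≤ jumpRate t p := by
  rw [jumpRate]; positivity

lemma hasSum_succ_mul_pow {r : ℝ} (h0 : 0 ≤ r) (h1 : r < 1) :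
    HasSum (fun a : ℕ => (a + 1 : ℝ) * r ^ (a + 1)) (r / (1 - r) ^ 2) := by
  have h : ‖r‖ < 1 := by rwa [Real.norm_of_nonneg h0]
  simp_rw [← Nat.cast_add_one]
  refine (hasSum_nat_add_iff (f := fun n : ℕ => (n : ℝ) * r ^ n) 1).2 ?_
  rw [sum_range_one, Nat.cast_zero, zero_mul, add_zero]
  exact hasSum_coe_mul_geometric_of_norm_lt_one h

lemma hasSum_succ_mul_exp {y : ℝ} (hy : 0 < y) :
    HasSum (fun a : ℕ => (a + 1 : ℝ) * Real.exp (-y) ^ (a + 1))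
      (Real.exp (-y) / (1 - Real.exp (-y)) ^ 2) :=
  hasSum_succ_mul_pow (Real.exp_pos _).le (Real.exp_lt_one_iff.2 (by linarith))

lemma jumpRate_mul_jumpSize (t : ℝ) (p : ℕ × ℕ) :
    jumpRate t p * jumpSize p =
      (p.1 + 1 : ℝ) * Real.exp (-((p.2 + 1) * t)) ^ (p.1 + 1) := by
  have h : (p.2 + 1 : ℝ) ≠ 0 := by positivity
  rw [jumpRate, jumpSize, ← Real.exp_nat_mul]
  push_cast
  rw [show -(t * ((p.1 + 1 : ℝ) * (p.2 + 1))) = (p.1 + 1) * -((p.2 + 1) * t) by ring]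
  field_simp

lemma summable_one_div_succ_sq : Summable fun b : ℕ => 1 / ((b : ℝ) + 1) ^ 2 := by
  have := (summable_nat_add_iff 1).2 hasSum_zeta_two.summable
  simpa using this

lemma tsum_one_div_succ_sq : ∑' b : ℕ, 1 / ((b : ℝ) + 1) ^ 2 = Real.pi ^ 2 / 6 := by
  have h2 := (hasSum_nat_add_iff' 1).2 hasSum_zeta_two
  have h3 : HasSum (fun b : ℕ => 1 / ((b : ℝ) + 1) ^ 2) (Real.pi ^ 2 / 6) := by simpa using h2
  exact h3.tsum_eq

lemma hasSum_one_div_succ_mul_sq {t : ℝ} (ht : 0 < t) :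
    HasSum (fun b : ℕ => 1 / (((b : ℝ) + 1) * t) ^ 2) (Real.pi ^ 2 / (6 * t ^ 2)) := by
  have h := (summable_one_div_succ_sq.hasSum).mul_right (1 / t ^ 2)
  rw [tsum_one_div_succ_sq] at h
  convert! h using 1
  · funext b; rw [mul_pow]; field_simp
  · field_simp

lemma summable_exp_neg_div_one_sub_sq {t : ℝ} (ht : 0 < t) :
    Summable fun b : ℕ => Real.exp (-((b + 1) * t)) / (1 - Real.exp (-((b + 1) * t))) ^ 2 :=
  Summable.of_nonneg_of_le (fun _ => by positivity)
    (fun _ => exp_neg_div_one_sub_sq_le (by positivity)) (hasSum_one_div_succ_mul_sq ht).summable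

lemma hasSum_jumpRate_mul_jumpSize {t : ℝ} (ht : 0 < t) :
    HasSum (fun p => jumpRate t p * jumpSize p)
      (∑' b : ℕ, Real.exp (-((b + 1) * t)) / (1 - Real.exp (-((b + 1) * t))) ^ 2) := by
  have hf : ∀ b : ℕ, HasSum (fun a : ℕ => jumpRate t (a, b) * jumpSize (a, b))
      (Real.exp (-((b + 1) * t)) / (1 - Real.exp (-((b + 1) * t))) ^ 2) := by
    intro b
    simp only [jumpRate_mul_jumpSize]
    exact hasSum_succ_mul_exp (by positivity)
  have hs : Summable fun p : ℕ × ℕ => jumpRate t p.swap * jumpSize p.swap := by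
    rw [summable_prod_of_nonneg fun p =>
      mul_nonneg (jumpRate_nonneg _ _) (zero_le_one.trans (one_le_jumpSize _))]
    refine ⟨fun b => (hf b).summable, ?_⟩
    simp only [Prod.swap_prod_mk, (hf _).tsum_eq]
    exact summable_exp_neg_div_one_sub_sq ht
  have h2 := hs.hasSum.prod_fiberwise hf
  rw [h2.tsum_eq]
  exact (Equiv.prodComm ℕ ℕ).hasSum_iff.1 hs.hasSum

/-- The mean of the Boltzmann model. -/
noncomputable def jumpMean (t : ℝ) : ℝ := ∑' p, jumpRate t p * jumpSize p

lemma jumpMean_eq {t : ℝ} (ht : 0 < t) : jumpMean t =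
    ∑' b : ℕ, Real.exp (-((b + 1) * t)) / (1 - Real.exp (-((b + 1) * t))) ^ 2 :=
  (hasSum_jumpRate_mul_jumpSize ht).tsum_eq

lemma jumpMean_le {t : ℝ} (ht : 0 < t) : jumpMean t ≤ Real.pi ^ 2 / (6 * t ^ 2) := by
  rw [jumpMean_eq ht, ← (hasSum_one_div_succ_mul_sq ht).tsum_eq]
  exact (summable_exp_neg_div_one_sub_sq ht).tsum_le_tsum
    (fun _ => exp_neg_div_one_sub_sq_le (by positivity)) (hasSum_one_div_succ_mul_sq ht).summable

lemma sum_range_one_div_sq_le {B : ℕ} (hB : 0 < B) (n : ℕ) :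
    ∑ i ∈ range n, 1 / ((B + i : ℕ) + 1 : ℝ) ^ 2 ≤ 1 / (B : ℝ) - 1 / (B + n : ℝ) := by
  induction n with
  | zero => simp
  | succ n ih =>
    rw [sum_range_succ]
    have hB' : (0 : ℝ) < B := by exact_mod_cast hB
    have : 1 / ((B + n : ℕ) + 1 : ℝ) ^ 2 ≤ 1 / (B + n : ℝ) - 1 / (B + (n + 1 : ℕ) : ℝ) := by
      push_cast
      rw [div_sub_div _ _ (by positivity) (by positivity), div_le_div_iff₀ (by positivity) (by positivity)]
      nlinarith [Nat.cast_nonneg (α := ℝ) n]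
    linarith

/-- The b-th defect from 1/((b+1)t)² is at most 1/4 and at most that term itself. The first bound is
used for b < B = ⌈1/t⌉, the second beyond, and each part is O(1/t). -/
lemma le_jumpMean {t : ℝ} (ht : 0 < t) (ht1 : t ≤ 1) :
    Real.pi ^ 2 / (6 * t ^ 2) - 2 / t ≤ jumpMean t := by
  have h1 := hasSum_one_div_succ_mul_sq ht
  have h2 := (summable_exp_neg_div_one_sub_sq ht).hasSum
  rw [← jumpMean_eq ht] at h2
  have h3 := h1.sub h2
  set g : ℕ → ℝ := fun b => 1 / (((b : ℝ) + 1) * t) ^ 2 -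
    Real.exp (-((b + 1) * t)) / (1 - Real.exp (-((b + 1) * t))) ^ 2 with hg
  have hg0 : ∀ b, 0 ≤ g b := fun b =>
    sub_nonneg.2 (exp_neg_div_one_sub_sq_le (by positivity))
  have hg1 : ∀ b, g b ≤ 1 / 4 := by
    intro b
    have := le_exp_neg_div_one_sub_sq (y := (b + 1) * t) (by positivity)
    simp only [hg]
    linarith
  have hg2 : ∀ b : ℕ, g b ≤ 1 / t ^ 2 * (1 / ((b : ℝ) + 1) ^ 2) := by
    intro b
    have : 0 ≤ Real.exp (-((b + 1) * t)) / (1 - Real.exp (-((b + 1) * t))) ^ 2 := by positivity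
    have h : 1 / t ^ 2 * (1 / ((b : ℝ) + 1) ^ 2) = 1 / (((b : ℝ) + 1) * t) ^ 2 := by
      rw [mul_pow]; field_simp
    rw [h]
    simp only [hg]
    linarith
  set B := ⌈1 / t⌉₊ with hB
  have hB1 : 1 / t ≤ B := Nat.le_ceil _
  have hB2 : (B : ℝ) < 1 / t + 1 := Nat.ceil_lt_add_one (by positivity)
  have hBpos : 0 < B := Nat.ceil_pos.2 (by positivity)
  have hB' : (0 : ℝ) < B := by exact_mod_cast hBpos
  have hle : ∀ n, ∑ b ∈ range n, g b ≤ 2 / t := by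
    intro n
    have h1t : 1 ≤ 1 / t := by rw [le_div_iff₀ ht]; linarith
    calc ∑ b ∈ range n, g b ≤ ∑ b ∈ range (B + n), g b :=
          sum_le_sum_of_subset_of_nonneg (range_mono (Nat.le_add_left _ _)) fun b _ _ => hg0 b
      _ = ∑ b ∈ range B, g b + ∑ i ∈ range n, g (B + i) := sum_range_add _ _ _
      _ ≤ ∑ b ∈ range B, 1 / 4 + ∑ i ∈ range n, 1 / t ^ 2 * (1 / ((B + i : ℕ) + 1 : ℝ) ^ 2) :=
          add_le_add (sum_le_sum fun b _ => hg1 b) (sum_le_sum fun i _ => hg2 _)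
      _ ≤ B / 4 + 1 / t ^ 2 * (1 / B) := by
          rw [← mul_sum, sum_const, card_range, nsmul_eq_mul]
          have h := sum_range_one_div_sq_le hBpos n
          have h' : 0 ≤ 1 / ((B : ℝ) + n) := by positivity
          have : ∑ i ∈ range n, 1 / ((B + i : ℕ) + 1 : ℝ) ^ 2 ≤ 1 / (B : ℝ) := by linarith
          have := mul_le_mul_of_nonneg_left this (show 0 ≤ 1 / t ^ 2 by positivity)
          linarith
      _ ≤ B / 4 + 1 / t := by
          have : 1 / (B : ℝ) ≤ t := by
            rw [div_le_iff₀ hB']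
            rw [div_le_iff₀ ht] at hB1
            linarith
          have h := mul_le_mul_of_nonneg_left this (show 0 ≤ 1 / t ^ 2 by positivity)
          have h' : 1 / t ^ 2 * t = 1 / t := by field_simp
          linarith
      _ ≤ 2 / t := by
          have : 2 / t = 2 * (1 / t) := by ring
          linarith
  have := le_of_tendsto' h3.tendsto_sum_nat hle
  linarith

lemma abs_jumpMean_sub_le {t : ℝ} (ht : 0 < t) (ht1 : t ≤ 1) :
    |jumpMean t - Real.pi ^ 2 / (6 * t ^ 2)| ≤ 2 / t := by
  have h1 := jumpMean_le ht
  have h2 := le_jumpMean ht ht1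
  have : 0 ≤ 2 / t := by positivity
  rw [abs_le]
  constructor <;> linarith

lemma mul_exp_neg_mul_le {s x : ℝ} (hs : 0 < s) : x * Real.exp (-(s * x)) ≤ 1 / s := by
  have h := Real.add_one_le_exp (s * x)
  rw [Real.exp_neg, ← div_eq_mul_inv, div_le_div_iff₀ (Real.exp_pos _) hs]
  linarith

lemma jumpRate_eq_half (t : ℝ) (p : ℕ × ℕ) :
    jumpRate t p = Real.exp (-(t / 2 * jumpSize p)) * jumpRate (t / 2) p := by
  rw [jumpRate, jumpRate, ← mul_div_assoc, ← Real.exp_add]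
  congr 2
  ring

/-- Half of the exponential absorbs the extra power of the jump size; the other half leaves the mean
at t/2. The cubic bound works in the same way. -/
lemma jumpRate_mul_sq_le {t : ℝ} (ht : 0 < t) (p : ℕ × ℕ) :
    jumpRate t p * jumpSize p ^ 2 ≤ 2 / t * (jumpRate (t / 2) p * jumpSize p) := by
  have h0 : 0 ≤ jumpRate (t / 2) p * jumpSize p :=
    mul_nonneg (jumpRate_nonneg _ _) (zero_le_one.trans (one_le_jumpSize _))
  have h := mul_exp_neg_mul_le (x := jumpSize p) (half_pos ht)
  calc _ = jumpSize p * Real.exp (-(t / 2 * jumpSize p)) * (jumpRate (t / 2) p * jumpSize p) := by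
        rw [jumpRate_eq_half]; ring
    _ ≤ 1 / (t / 2) * (jumpRate (t / 2) p * jumpSize p) := by gcongr
    _ = _ := by rw [one_div_div]

lemma jumpRate_mul_cube_le {t : ℝ} (ht : 0 < t) (p : ℕ × ℕ) :
    jumpRate t p * jumpSize p ^ 3 ≤ 16 / t ^ 2 * (jumpRate (t / 2) p * jumpSize p) := by
  have h0 : 0 ≤ jumpRate (t / 2) p * jumpSize p :=
    mul_nonneg (jumpRate_nonneg _ _) (zero_le_one.trans (one_le_jumpSize _))
  have h1 : 0 ≤ jumpSize p := zero_le_one.trans (one_le_jumpSize _)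
  have h := mul_exp_neg_mul_le (s := t / 4) (x := jumpSize p) (by positivity)
  have he : Real.exp (-(t / 2 * jumpSize p)) = Real.exp (-(t / 4 * jumpSize p)) ^ 2 := by
    rw [← Real.exp_nat_mul]; congr 1; push_cast; ring
  calc _ = (jumpSize p * Real.exp (-(t / 4 * jumpSize p))) ^ 2 *
          (jumpRate (t / 2) p * jumpSize p) := by
        rw [jumpRate_eq_half, he]; ring
    _ ≤ (1 / (t / 4)) ^ 2 * (jumpRate (t / 2) p * jumpSize p) := by gcongr
    _ = _ := by rw [one_div_div, div_pow]; norm_num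

lemma summable_jumpRate_mul_jumpSize {t : ℝ} (ht : 0 < t) :
    Summable fun p => jumpRate t p * jumpSize p := (hasSum_jumpRate_mul_jumpSize ht).summable

lemma summable_jumpRate {t : ℝ} (ht : 0 < t) : Summable (jumpRate t) :=
  Summable.of_nonneg_of_le (jumpRate_nonneg t)
    (fun p => le_mul_of_one_le_right (jumpRate_nonneg t p) (one_le_jumpSize p))
    (summable_jumpRate_mul_jumpSize ht)

lemma summable_jumpRate_mul_sq {t : ℝ} (ht : 0 < t) :
    Summable fun p => jumpRate t p * jumpSize p ^ 2 :=
  Summable.of_nonneg_of_le (fun p => mul_nonneg (jumpRate_nonneg t p) (sq_nonneg _))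
    (jumpRate_mul_sq_le ht) ((summable_jumpRate_mul_jumpSize (half_pos ht)).mul_left _)

lemma summable_jumpRate_mul_cube {t : ℝ} (ht : 0 < t) :
    Summable fun p => jumpRate t p * jumpSize p ^ 3 :=
  Summable.of_nonneg_of_le (fun p => mul_nonneg (jumpRate_nonneg t p)
      (pow_nonneg (zero_le_one.trans (one_le_jumpSize p)) _))
    (jumpRate_mul_cube_le ht) ((summable_jumpRate_mul_jumpSize (half_pos ht)).mul_left _)

/-- The variance of the Boltzmann model. -/
noncomputable def jumpVar (t : ℝ) : ℝ := ∑' p, jumpRate t p * jumpSize p ^ 2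

lemma jumpMean_half_le {t : ℝ} (ht : 0 < t) : jumpMean (t / 2) ≤ 20 / (3 * t ^ 2) := by
  refine (jumpMean_le (half_pos ht)).trans ?_
  rw [div_le_div_iff₀ (by positivity) (by positivity)]
  have hpi : Real.pi ^ 2 ≤ 10 := by nlinarith [Real.pi_lt_d2, Real.pi_pos]
  nlinarith [mul_le_mul_of_nonneg_right hpi (sq_nonneg t)]

lemma jumpVar_le {t : ℝ} (ht : 0 < t) : jumpVar t ≤ 14 / t ^ 3 := by
  calc jumpVar t ≤ ∑' p, 2 / t * (jumpRate (t / 2) p * jumpSize p) :=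
        (summable_jumpRate_mul_sq ht).tsum_le_tsum (jumpRate_mul_sq_le ht)
          ((summable_jumpRate_mul_jumpSize (half_pos ht)).mul_left _)
    _ = 2 / t * jumpMean (t / 2) := by rw [tsum_mul_left, jumpMean]
    _ ≤ 2 / t * (20 / (3 * t ^ 2)) := by gcongr; exact jumpMean_half_le ht
    _ = 40 / 3 / t ^ 3 := by field_simp; norm_num
    _ ≤ _ := by gcongr; norm_num

lemma tsum_jumpRate_mul_cube_le {t : ℝ} (ht : 0 < t) :
    ∑' p, jumpRate t p * jumpSize p ^ 3 ≤ 107 / t ^ 4 := by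
  calc _ ≤ ∑' p, 16 / t ^ 2 * (jumpRate (t / 2) p * jumpSize p) :=
        (summable_jumpRate_mul_cube ht).tsum_le_tsum (jumpRate_mul_cube_le ht)
          ((summable_jumpRate_mul_jumpSize (half_pos ht)).mul_left _)
    _ = 16 / t ^ 2 * jumpMean (t / 2) := by rw [tsum_mul_left, jumpMean]
    _ ≤ 16 / t ^ 2 * (20 / (3 * t ^ 2)) := by gcongr; exact jumpMean_half_le ht
    _ = 320 / 3 / t ^ 4 := by field_simp; norm_num
    _ ≤ _ := by gcongr; norm_num

end Moments

/-! ### The characteristic function: decay and Taylor expansion -/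

section CharFun

open Filter Topology

/-- The characteristic function of the size of a Boltzmann partition, as that of a compound Poisson
variable. -/
noncomputable def jumpChar (t θ : ℝ) : ℂ :=
  Complex.exp (∑' p, (jumpRate t p : ℂ) * (Complex.exp ((jumpSize p * θ : ℝ) * Complex.I) - 1))

lemma norm_jumpRate_mul_exp_sub_one_le (t θ : ℝ) (p : ℕ × ℕ) :
    ‖(jumpRate t p : ℂ) * (Complex.exp ((jumpSize p * θ : ℝ) * Complex.I) - 1)‖ ≤
      jumpRate t p * 2 := by
  rw [norm_mul, Complex.norm_real, Real.norm_of_nonneg (jumpRate_nonneg t p)]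
  refine mul_le_mul_of_nonneg_left ((norm_sub_le _ _).trans ?_) (jumpRate_nonneg t p)
  rw [Complex.norm_exp_ofReal_mul_I, norm_one]
  norm_num

lemma summable_jumpRate_mul_exp_sub_one {t : ℝ} (ht : 0 < t) (θ : ℝ) :
    Summable fun p =>
      (jumpRate t p : ℂ) * (Complex.exp ((jumpSize p * θ : ℝ) * Complex.I) - 1) :=
  Summable.of_norm_bounded ((summable_jumpRate ht).mul_right 2)
    (norm_jumpRate_mul_exp_sub_one_le t θ)

lemma continuous_jumpChar {t : ℝ} (ht : 0 < t) : Continuous (jumpChar t) := by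
  refine Complex.continuous_exp.comp ?_
  refine continuous_tsum (fun p => by fun_prop) ((summable_jumpRate ht).mul_right 2) fun p θ =>
    norm_jumpRate_mul_exp_sub_one_le t θ p

lemma logTerm_exp (t θ : ℝ) (p : ℕ × ℕ) :
    logTerm (Complex.exp (-t + θ * Complex.I)) p =
      jumpRate t p * Complex.exp ((jumpSize p * θ : ℝ) * Complex.I) := by
  rw [logTerm, jumpRate, jumpSize, ← Complex.exp_nat_mul]
  push_cast
  rw [div_mul_eq_mul_div, ← Complex.exp_add]
  congr 2
  ring

lemma exp_tsum_logTerm_eq {t : ℝ} (ht : 0 < t) (θ : ℝ) :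
    Complex.exp (∑' p, logTerm (Complex.exp (-t + θ * Complex.I)) p) =
      (Real.exp (∑' p, jumpRate t p) : ℝ) * jumpChar t θ := by
  rw [jumpChar, Complex.ofReal_exp, ← Complex.exp_add, Complex.ofReal_tsum,
    ← Summable.tsum_add (Complex.hasSum_ofReal.2 (summable_jumpRate ht).hasSum).summable
      (summable_jumpRate_mul_exp_sub_one ht θ)]
  congr 1
  refine tsum_congr fun p => ?_
  rw [logTerm_exp]
  ring

lemma re_jumpRate_mul_exp_sub_one (t θ : ℝ) (p : ℕ × ℕ) :
    ((jumpRate t p : ℂ) * (Complex.exp ((jumpSize p * θ : ℝ) * Complex.I) - 1)).re =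
      -(jumpRate t p * (1 - Real.cos (jumpSize p * θ))) := by
  rw [Complex.re_ofReal_mul, Complex.sub_re, Complex.exp_ofReal_mul_I_re, Complex.one_re]
  ring

lemma summable_jumpRate_mul_one_sub_cos {t : ℝ} (ht : 0 < t) (θ : ℝ) :
    Summable fun p => jumpRate t p * (1 - Real.cos (jumpSize p * θ)) := by
  have := (Complex.hasSum_re (summable_jumpRate_mul_exp_sub_one ht θ).hasSum).summable.neg
  simpa only [re_jumpRate_mul_exp_sub_one, neg_neg] using this

lemma re_tsum_jumpRate_mul_exp_sub_one {t : ℝ} (ht : 0 < t) (θ : ℝ) :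
    (∑' p, (jumpRate t p : ℂ) * (Complex.exp ((jumpSize p * θ : ℝ) * Complex.I) - 1)).re =
      -∑' p, jumpRate t p * (1 - Real.cos (jumpSize p * θ)) := by
  rw [Complex.re_tsum (summable_jumpRate_mul_exp_sub_one ht θ), ← tsum_neg]
  exact tsum_congr fun p => re_jumpRate_mul_exp_sub_one t θ p

lemma norm_jumpChar {t : ℝ} (ht : 0 < t) (θ : ℝ) :
    ‖jumpChar t θ‖ = Real.exp (-∑' p, jumpRate t p * (1 - Real.cos (jumpSize p * θ))) := by
  rw [jumpChar, Complex.norm_exp, re_tsum_jumpRate_mul_exp_sub_one ht]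

lemma tsum_jumpRate_mul_one_sub_cos_le {t : ℝ} (ht : 0 < t) (θ : ℝ) :
    ∑' p, jumpRate t p * (1 - Real.cos (jumpSize p * θ)) ≤ θ ^ 2 / 2 * jumpVar t := by
  rw [jumpVar, ← tsum_mul_left]
  refine (summable_jumpRate_mul_one_sub_cos ht θ).tsum_le_tsum (fun p => ?_)
    ((summable_jumpRate_mul_sq ht).mul_left _)
  have h := Real.one_sub_sq_div_two_le_cos (x := jumpSize p * θ)
  calc _ ≤ jumpRate t p * ((jumpSize p * θ) ^ 2 / 2) :=
        mul_le_mul_of_nonneg_left (by linarith) (jumpRate_nonneg t p)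
    _ = _ := by ring

/-- The slice b = 1 has rates e^{-ta}, so its sum is the difference of two geometric series, q/(1 -
q) and the real part of z/(1 - z) with z = q e^{iθ}. -/
lemma hasSum_pow_mul_one_sub_cos {t : ℝ} (ht : 0 < t) (θ : ℝ) :
    HasSum (fun a : ℕ => jumpRate t (a, 0) * (1 - Real.cos (jumpSize (a, 0) * θ)))
      (Real.exp (-t) * (1 + Real.exp (-t)) * (1 - Real.cos θ) /
        ((1 - Real.exp (-t)) *
          ((1 - Real.exp (-t)) ^ 2 + 2 * Real.exp (-t) * (1 - Real.cos θ)))) := by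
  set q := Real.exp (-t) with hq
  have hq0 : 0 < q := Real.exp_pos _
  have hq1 : q < 1 := Real.exp_lt_one_iff.2 (by linarith)
  set z : ℂ := q * Complex.exp (θ * Complex.I) with hz
  have hzn : ‖z‖ < 1 := by
    rw [hz, norm_mul, Complex.norm_exp_ofReal_mul_I, Complex.norm_real,
      Real.norm_of_nonneg hq0.le, mul_one]
    exact hq1
  have h1 := (hasSum_geometric_of_lt_one hq0.le hq1).mul_right q
  have h2 := Complex.hasSum_re ((hasSum_geometric_of_norm_lt_one hzn).mul_right z)
  have hre : z.re = q * Real.cos θ := by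
    rw [hz, Complex.re_ofReal_mul, Complex.exp_ofReal_mul_I_re]
  have him : z.im = q * Real.sin θ := by
    rw [hz, Complex.im_ofReal_mul, Complex.exp_ofReal_mul_I_im]
  convert! h1.sub h2 using 1
  · funext a
    have hp : z ^ a * z = ((q ^ (a + 1) : ℝ) : ℂ) * Complex.exp (((a + 1 : ℝ) * θ : ℝ) * Complex.I) := by
      rw [← pow_succ, hz, mul_pow, ← Complex.exp_nat_mul]
      push_cast
      congr 2
      ring
    rw [hp, Complex.re_ofReal_mul, Complex.exp_ofReal_mul_I_re, jumpRate, jumpSize, ← pow_succ]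
    have : Real.exp (-(t * (((a : ℕ) + 1 : ℝ) * ((0 : ℕ) + 1)))) = q ^ (a + 1) := by
      rw [hq, ← Real.exp_nat_mul]
      congr 1
      push_cast
      ring
    simp only [this]
    norm_num
    ring
  · rw [Complex.mul_re, Complex.inv_re, Complex.inv_im, Complex.normSq_apply]
    simp only [Complex.sub_re, Complex.sub_im, Complex.one_re, Complex.one_im, hre, him]
    have hs : Real.sin θ ^ 2 = 1 - Real.cos θ ^ 2 := Real.sin_sq θ
    have hD : (1 - q * Real.cos θ) * (1 - q * Real.cos θ) +
        (0 - q * Real.sin θ) * (0 - q * Real.sin θ) =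
          (1 - q) ^ 2 + 2 * q * (1 - Real.cos θ) := by
      linear_combination q ^ 2 * hs
    rw [hD]
    have hDpos : 0 < (1 - q) ^ 2 + 2 * q * (1 - Real.cos θ) := by
      have h3 : 0 < (1 - q) ^ 2 := pow_pos (by linarith) 2
      have h4 : 0 ≤ 2 * q * (1 - Real.cos θ) :=
        mul_nonneg (by linarith) (by linarith [Real.cos_le_one θ])
      linarith
    have h1q : 1 - q ≠ 0 := by linarith
    obtain ⟨D, hDdef⟩ : ∃ D, D = (1 - q) ^ 2 + 2 * q * (1 - Real.cos θ) := ⟨_, rfl⟩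
    rw [← hDdef] at hDpos ⊢
    have hre' : (1 - q * Real.cos θ) / D * (q * Real.cos θ) -
        -(0 - q * Real.sin θ) / D * (q * Real.sin θ) = (q * Real.cos θ - q ^ 2) / D := by
      rw [div_mul_eq_mul_div, div_mul_eq_mul_div, ← sub_div]
      congr 1
      linear_combination (-q ^ 2) * hs
    rw [hre', inv_mul_eq_div, div_sub_div _ _ h1q hDpos.ne']
    congr 1
    rw [hDdef]
    ring

/-- Lower bound for the exponential decay rate of the characteristic function. -/
lemma le_tsum_jumpRate_mul_one_sub_cos {t θ : ℝ} (ht : 0 < t) (ht1 : t ≤ 1)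
    (hθ : |θ| ≤ Real.pi) :
    θ ^ 2 / (2 * (t * (8 * t ^ 2 + θ ^ 2))) ≤
      ∑' p, jumpRate t p * (1 - Real.cos (jumpSize p * θ)) := by
  -- All terms are nonnegative, and this single slice already gives decay of the right order.
  have hslice : ∑' a : ℕ, jumpRate t (a, 0) * (1 - Real.cos (jumpSize (a, 0) * θ)) ≤
      ∑' p, jumpRate t p * (1 - Real.cos (jumpSize p * θ)) :=
    Summable.tsum_le_tsum_of_inj (fun a : ℕ => ((a, 0) : ℕ × ℕ)) (fun a b h => (Prod.mk.inj h).1)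
      (fun p _ => mul_nonneg (jumpRate_nonneg t p)
        (by linarith [Real.cos_le_one (jumpSize p * θ)]))
      (fun _ => le_rfl) (hasSum_pow_mul_one_sub_cos ht θ).summable
      (summable_jumpRate_mul_one_sub_cos ht θ)
  refine le_trans ?_ hslice
  rw [(hasSum_pow_mul_one_sub_cos ht θ).tsum_eq]
  set q := Real.exp (-t) with hq
  have hq1 : q < 1 := Real.exp_lt_one_iff.2 (by linarith)
  have hqt : 1 - q ≤ t := by linarith [Real.add_one_le_exp (-t)]
  have hq3 : 1 / 3 ≤ q := by
    have h1 : Real.exp (-1) ≤ q := Real.exp_le_exp.2 (by linarith)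
    have h2 : 1 / 3 ≤ Real.exp (-1) := by
      rw [Real.exp_neg, ← one_div]
      exact one_div_le_one_div_of_le (Real.exp_pos _) (by linarith [Real.exp_one_lt_d9])
    linarith
  -- Combines q ≥ 1/3 with 1 - cos θ ≥ 2θ²/π² ≥ 3θ²/16 on [-π, π].
  have hu : θ ^ 2 / 16 ≤ q * (1 - Real.cos θ) := by
    have h1 := Real.cos_le_one_sub_mul_cos_sq hθ
    have h2 : 3 / 16 ≤ 2 / Real.pi ^ 2 := by
      rw [div_le_div_iff₀ (by norm_num) (by positivity)]
      nlinarith [Real.pi_lt_d2, Real.pi_pos]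
    have h3 : 3 / 16 * θ ^ 2 ≤ 1 - Real.cos θ := by
      nlinarith [mul_le_mul_of_nonneg_right h2 (sq_nonneg θ)]
    nlinarith [sq_nonneg θ]
  set u := 1 - Real.cos θ
  have hv : 0 ≤ q * u := le_trans (by positivity) hu
  have h1q : 0 < 1 - q := by linarith
  have hpos : 0 < (1 - q) * ((1 - q) ^ 2 + 2 * (q * u)) := by positivity
  calc θ ^ 2 / (2 * (t * (8 * t ^ 2 + θ ^ 2))) = (θ ^ 2 / 16) / (t * (t ^ 2 + 2 * (θ ^ 2 / 16))) := by
        have : 0 < 8 * t ^ 2 + θ ^ 2 := by positivity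
        have : 0 < t ^ 2 + 2 * (θ ^ 2 / 16) := by positivity
        rw [div_eq_div_iff (by positivity) (by positivity)]
        ring
    _ ≤ (q * u) / (t * (t ^ 2 + 2 * (q * u))) := by
        rw [div_le_div_iff₀ (by positivity) (by positivity)]
        nlinarith [mul_le_mul_of_nonneg_right hu (show 0 ≤ t ^ 3 by positivity)]
    _ ≤ (q * u) / ((1 - q) * ((1 - q) ^ 2 + 2 * (q * u))) := by gcongr
    _ ≤ q * (1 + q) * u / ((1 - q) * ((1 - q) ^ 2 + 2 * q * u)) := by
        rw [mul_assoc 2 q u]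
        exact div_le_div_of_nonneg_right (by nlinarith) hpos.le

lemma norm_jumpChar_le_of_le {t θ : ℝ} (ht : 0 < t) (ht1 : t ≤ 1) (hθ : |θ| ≤ t) :
    ‖jumpChar t θ‖ ≤ Real.exp (-(θ ^ 2 / (18 * t ^ 3))) := by
  rw [norm_jumpChar ht, Real.exp_le_exp, neg_le_neg_iff]
  refine le_trans ?_ (le_tsum_jumpRate_mul_one_sub_cos ht ht1
    (hθ.trans (ht1.trans (by linarith [Real.pi_gt_three]))))
  have : θ ^ 2 ≤ t ^ 2 := sq_le_sq' (by linarith [abs_le.1 hθ]) (abs_le.1 hθ).2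
  refine div_le_div_of_nonneg_left (sq_nonneg θ) (by positivity) ?_
  nlinarith

lemma norm_jumpChar_le_of_ge {t θ : ℝ} (ht : 0 < t) (ht1 : t ≤ 1) (hθ : t ≤ |θ|)
    (hθ' : |θ| ≤ Real.pi) : ‖jumpChar t θ‖ ≤ Real.exp (-(1 / (18 * t))) := by
  rw [norm_jumpChar ht, Real.exp_le_exp, neg_le_neg_iff]
  refine le_trans ?_ (le_tsum_jumpRate_mul_one_sub_cos ht ht1 hθ')
  have h : t ^ 2 ≤ θ ^ 2 := by rw [← sq_abs θ]; gcongr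
  rw [div_le_div_iff₀ (by positivity) (by positivity)]
  nlinarith

lemma norm_exp_mul_I_sub_taylor_le (x : ℝ) :
    ‖Complex.exp (x * Complex.I) - 1 - x * Complex.I + x ^ 2 / 2‖ ≤ 4 * |x| ^ 3 := by
  rcases le_or_gt |x| 1 with h | h
  · have hn : ‖(x * Complex.I : ℂ)‖ = |x| := by simp
    have := Complex.exp_bound (x := x * Complex.I) (by rw [hn]; exact h) (n := 3) (by norm_num)
    rw [hn] at this
    simp only [sum_range_succ, sum_range_zero] at this
    norm_num [Nat.factorial] at this
    calc _ = ‖Complex.exp (x * Complex.I) - (1 + x * Complex.I + (x * Complex.I) ^ 2 / 2)‖ := by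
          congr 1
          rw [mul_pow, Complex.I_sq]
          ring
      _ ≤ |x| ^ 3 * (2 / 9) := this
      _ ≤ _ := by nlinarith [pow_nonneg (abs_nonneg x) 3]
  · have h1 : ‖(x : ℂ) * Complex.I‖ = |x| := by simp
    have h2 : ‖(x : ℂ) ^ 2 / 2‖ = |x| ^ 2 / 2 := by simp
    calc _ ≤ ‖Complex.exp (x * Complex.I) - 1 - x * Complex.I‖ + ‖(x : ℂ) ^ 2 / 2‖ := norm_add_le _ _
      _ ≤ ‖Complex.exp (x * Complex.I) - 1‖ + ‖(x : ℂ) * Complex.I‖ + ‖(x : ℂ) ^ 2 / 2‖ := by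
          gcongr; exact norm_sub_le _ _
      _ ≤ ‖Complex.exp (x * Complex.I)‖ + ‖(1 : ℂ)‖ + ‖(x : ℂ) * Complex.I‖ + ‖(x : ℂ) ^ 2 / 2‖ := by
          gcongr; exact norm_sub_le _ _
      _ = 2 + |x| + |x| ^ 2 / 2 := by
          rw [h1, h2, Complex.norm_exp_ofReal_mul_I, norm_one]; norm_num
      _ ≤ _ := by nlinarith [mul_pos (zero_lt_one.trans h) (zero_lt_one.trans h), pow_pos (zero_lt_one.trans h) 3]

/-- Third order Taylor expansion of the logarithm of the characteristic function. -/
lemma norm_tsum_sub_taylor_le {t : ℝ} (ht : 0 < t) (θ : ℝ) :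
    ‖(∑' p, (jumpRate t p : ℂ) * (Complex.exp ((jumpSize p * θ : ℝ) * Complex.I) - 1)) -
      (jumpMean t * θ * Complex.I - θ ^ 2 / 2 * jumpVar t)‖ ≤ 428 * |θ| ^ 3 / t ^ 4 := by
  have h1 := (summable_jumpRate_mul_exp_sub_one ht θ).hasSum
  have h2 := (Complex.hasSum_ofReal.2 (summable_jumpRate_mul_jumpSize ht).hasSum).mul_right
    ((θ : ℂ) * Complex.I)
  have h3 := (Complex.hasSum_ofReal.2 (summable_jumpRate_mul_sq ht).hasSum).mul_left
    ((θ : ℂ) ^ 2 / 2)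
  have h4 := h1.sub (h2.sub h3)
  have hb : ∀ p, ‖(jumpRate t p : ℂ) * (Complex.exp ((jumpSize p * θ : ℝ) * Complex.I) - 1) -
      (((jumpRate t p * jumpSize p : ℝ) : ℂ) * ((θ : ℂ) * Complex.I) -
        (θ : ℂ) ^ 2 / 2 * ((jumpRate t p * jumpSize p ^ 2 : ℝ) : ℂ))‖ ≤
      4 * |θ| ^ 3 * (jumpRate t p * jumpSize p ^ 3) := by
    intro p
    have he : (jumpRate t p : ℂ) * (Complex.exp ((jumpSize p * θ : ℝ) * Complex.I) - 1) -
      (((jumpRate t p * jumpSize p : ℝ) : ℂ) * ((θ : ℂ) * Complex.I) -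
        (θ : ℂ) ^ 2 / 2 * ((jumpRate t p * jumpSize p ^ 2 : ℝ) : ℂ)) =
      (jumpRate t p : ℂ) * (Complex.exp ((jumpSize p * θ : ℝ) * Complex.I) - 1 -
        (jumpSize p * θ : ℝ) * Complex.I + ((jumpSize p * θ : ℝ) : ℂ) ^ 2 / 2) := by
      push_cast
      ring
    rw [he, norm_mul, Complex.norm_real, Real.norm_of_nonneg (jumpRate_nonneg t p)]
    have := mul_le_mul_of_nonneg_left (norm_exp_mul_I_sub_taylor_le (jumpSize p * θ))
      (jumpRate_nonneg t p)
    refine this.trans (le_of_eq ?_)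
    rw [abs_mul, abs_of_nonneg (zero_le_one.trans (one_le_jumpSize p))]
    ring
  have h5 := tsum_of_norm_bounded ((summable_jumpRate_mul_cube ht).hasSum.mul_left (4 * |θ| ^ 3)) hb
  rw [h4.tsum_eq] at h5
  have h6 := mul_le_mul_of_nonneg_left (tsum_jumpRate_mul_cube_le ht)
    (show 0 ≤ 4 * |θ| ^ 3 by positivity)
  refine le_trans (le_of_eq ?_) (h5.trans (h6.trans (le_of_eq (by ring))))
  rw [jumpMean, jumpVar, mul_assoc]

end CharFun

/-! ### Fourier inversion for p(n) -/

section Fourier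

open Filter Topology MeasureTheory

lemma integral_exp_int_mul_I (m n : ℕ) :
    ∫ θ in (-Real.pi)..Real.pi, Complex.exp (((m : ℂ) - n) * Complex.I * θ) =
      if m = n then (2 * Real.pi : ℂ) else 0 := by
  split_ifs with h
  · subst h
    simp
    ring
  · have hc : ((m : ℂ) - n) * Complex.I ≠ 0 :=
      mul_ne_zero (sub_ne_zero.2 (Nat.cast_injective.ne h)) Complex.I_ne_zero
    rw [integral_exp_mul_complex hc]
    have : Complex.exp (((m : ℂ) - n) * Complex.I * (Real.pi : ℝ)) =
        Complex.exp (((m : ℂ) - n) * Complex.I * (-Real.pi : ℝ)) := by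
      rw [Complex.exp_eq_exp_iff_exists_int]
      refine ⟨(m : ℤ) - n, ?_⟩
      push_cast
      ring
    rw [this, sub_self, zero_div]

lemma integral_jumpChar {t : ℝ} (ht : 0 < t) (n : ℕ) :
    (Real.exp (∑' p, jumpRate t p) : ℂ) *
      ∫ θ in (-Real.pi)..Real.pi, jumpChar t θ * Complex.exp (-(n * θ : ℝ) * Complex.I) =
    2 * Real.pi * (numPartitions n * Real.exp (-(t * n)) : ℝ) := by
  have hr : Real.exp (-t) < 1 := Real.exp_lt_one_iff.2 (by linarith)
  have hz : ∀ θ : ℝ, ‖Complex.exp (-t + θ * Complex.I)‖ < 1 := by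
    intro θ
    rw [Complex.norm_exp]
    simpa using ht
  have hF : ∀ (m : ℕ) (θ : ℝ), (numPartitions m : ℂ) * Complex.exp (-t + θ * Complex.I) ^ m *
      Complex.exp (-(n * θ : ℝ) * Complex.I) =
      (numPartitions m * Real.exp (-t) ^ m : ℝ) *
        Complex.exp (((m : ℂ) - n) * Complex.I * θ) := by
    intro m θ
    push_cast
    rw [← Complex.exp_nat_mul, ← Complex.exp_nat_mul, mul_assoc, mul_assoc, ← Complex.exp_add,
      ← Complex.exp_add]
    congr 2
    ring
  have key := intervalIntegral.hasSum_integral_of_dominated_convergence (μ := volume)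
    (a := -Real.pi) (b := Real.pi)
    (F := fun (m : ℕ) (θ : ℝ) => (numPartitions m : ℂ) * Complex.exp (-t + θ * Complex.I) ^ m *
      Complex.exp (-(n * θ : ℝ) * Complex.I))
    (f := fun θ => (Real.exp (∑' p, jumpRate t p) : ℂ) *
      (jumpChar t θ * Complex.exp (-(n * θ : ℝ) * Complex.I)))
    (fun m _ => (numPartitions m : ℝ) * Real.exp (-t) ^ m)
    (fun m => Continuous.aestronglyMeasurable (by fun_prop))
    (fun m => Eventually.of_forall fun θ _ => by
      rw [hF, norm_mul, Complex.norm_real, Real.norm_of_nonneg (by positivity)]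
      refine (mul_le_of_le_one_right (by positivity) (le_of_eq ?_))
      rw [Complex.norm_exp]
      simp)
    (Eventually.of_forall fun θ _ => summable_numPartitions_mul_pow (Real.exp_pos _).le hr)
    intervalIntegrable_const
    (Eventually.of_forall fun θ _ => by
      have h := (hasSum_numPartitions_mul_pow (hz θ)).mul_right
        (Complex.exp (-(n * θ : ℝ) * Complex.I))
      rwa [exp_tsum_logTerm_eq ht, mul_assoc] at h)
  rw [intervalIntegral.integral_const_mul] at key
  have h2 : HasSum (fun m : ℕ => ∫ θ in (-Real.pi)..Real.pi, (numPartitions m : ℂ) *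
      Complex.exp (-t + θ * Complex.I) ^ m * Complex.exp (-(n * θ : ℝ) * Complex.I))
      ((numPartitions n * Real.exp (-t) ^ n : ℝ) * (2 * Real.pi : ℂ)) := by
    convert! hasSum_ite_eq n (((numPartitions n * Real.exp (-t) ^ n : ℝ) : ℂ) * (2 * Real.pi : ℂ))
      using 1
    funext m
    simp only [hF]
    rw [intervalIntegral.integral_const_mul, integral_exp_int_mul_I]
    split_ifs with h
    · rw [h]
    · rw [mul_zero]
  rw [key.unique h2, ← Real.exp_nat_mul, mul_comm, mul_neg, mul_comm (n : ℝ) t]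

end Fourier

/-! ### Local limit bounds, above for every size and below at the critical size -/

section LocalLimit

open Filter Topology MeasureTheory

lemma integral_exp_neg_sq_div_le {b : ℝ} (hb : 0 < b) :
    ∫ θ in (-Real.pi)..Real.pi, Real.exp (-(θ ^ 2 / b)) ≤ √(Real.pi * b) := by
  have he : ∀ θ : ℝ, Real.exp (-(θ ^ 2 / b)) = Real.exp (-(1 / b) * θ ^ 2) := fun θ => by
    congr 1; ring
  simp only [he]
  have hg := integral_gaussian (1 / b)
  rw [div_div_eq_mul_div, div_one] at hg
  rw [← hg, intervalIntegral.integral_of_le (by linarith [Real.pi_pos])]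
  exact setIntegral_le_integral (integrable_exp_neg_mul_sq (by positivity))
    (Eventually.of_forall fun _ => (Real.exp_pos _).le)

lemma exp_neg_one_div_le {t : ℝ} (ht : 0 < t) :
    Real.exp (-(1 / (18 * t))) ≤ 648 * (√t * (t * √t)) := by
  have hx : 0 ≤ 1 / (18 * t) := by positivity
  have h := Real.quadratic_le_exp_of_nonneg hx
  have hs : √t * (t * √t) = t ^ 2 := by
    have := Real.mul_self_sqrt ht.le
    linear_combination t * this
  rw [hs, Real.exp_neg, inv_le_comm₀ (Real.exp_pos _) (by positivity)]
  refine le_trans ?_ h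
  have : (648 * t ^ 2)⁻¹ = (1 / (18 * t)) ^ 2 / 2 := by field_simp; norm_num
  rw [this]
  linarith

lemma sqrt_pi_mul_le {t b B : ℝ} (ht : 0 < t) (hB : 0 ≤ B) (h : Real.pi * b ≤ B ^ 2) :
    √(Real.pi * (b * t ^ 3)) ≤ B * (t * √t) := by
  refine Real.sqrt_le_iff.2 ⟨by positivity, ?_⟩
  rw [mul_pow, mul_pow, Real.sq_sqrt ht.le]
  nlinarith [mul_le_mul_of_nonneg_right h (show 0 ≤ t ^ 3 by positivity)]

lemma norm_jumpChar_le {t θ : ℝ} (ht : 0 < t) (ht1 : t ≤ 1) (hθ : |θ| ≤ Real.pi) :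
    ‖jumpChar t θ‖ ≤ Real.exp (-(θ ^ 2 / (18 * t ^ 3))) + Real.exp (-(1 / (18 * t))) := by
  rcases le_total |θ| t with h | h
  · exact (norm_jumpChar_le_of_le ht ht1 h).trans (le_add_of_nonneg_right (Real.exp_pos _).le)
  · exact (norm_jumpChar_le_of_ge ht ht1 h hθ).trans (le_add_of_nonneg_left (Real.exp_pos _).le)

lemma norm_exp_neg_ofReal_mul_I (x : ℝ) : ‖Complex.exp (-(x : ℂ) * Complex.I)‖ = 1 := by
  rw [← Complex.ofReal_neg, Complex.norm_exp_ofReal_mul_I]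

/-- Only the modulus of the characteristic function enters, so the bound is uniform in n and will
apply to n - k at the rate chosen for n. -/
lemma norm_integral_jumpChar_le {t : ℝ} (ht : 0 < t) (ht1 : t ≤ 1) (n : ℕ) :
    ‖∫ θ in (-Real.pi)..Real.pi, jumpChar t θ * Complex.exp (-(n * θ : ℝ) * Complex.I)‖ ≤
      5000 * (t * √t) := by
  have hpi := Real.pi_pos
  have hmem : ∀ θ : ℝ, θ ∈ Set.Ioc (-Real.pi) Real.pi → |θ| ≤ Real.pi := fun θ h =>
    abs_le.2 ⟨h.1.le, h.2⟩
  have h1 := intervalIntegral.norm_integral_le_of_norm_le (μ := volume) (a := -Real.pi)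
    (b := Real.pi) (f := fun θ => jumpChar t θ * Complex.exp (-(n * θ : ℝ) * Complex.I))
    (g := fun θ => Real.exp (-(θ ^ 2 / (18 * t ^ 3))) + Real.exp (-(1 / (18 * t))))
    (by linarith) (Eventually.of_forall fun θ hθ => by
      rw [norm_mul, norm_exp_neg_ofReal_mul_I, mul_one]
      exact norm_jumpChar_le ht ht1 (hmem θ hθ))
    (Continuous.intervalIntegrable (by fun_prop) _ _)
  rw [intervalIntegral.integral_add (Continuous.intervalIntegrable (by fun_prop) _ _)
    intervalIntegrable_const, intervalIntegral.integral_const, smul_eq_mul] at h1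
  have h2 := (integral_exp_neg_sq_div_le (b := 18 * t ^ 3) (by positivity)).trans
    (sqrt_pi_mul_le (B := 8) ht (by norm_num) (by linarith [Real.pi_lt_d2]))
  have h3 := exp_neg_one_div_le ht
  have hs : √t ≤ 1 := Real.sqrt_le_one.2 ht1
  have hts : 0 ≤ t * √t := by positivity
  have h4 : √t * (t * √t) ≤ t * √t := mul_le_of_le_one_left hts hs
  have h5 : (Real.pi - -Real.pi) * Real.exp (-(1 / (18 * t))) ≤ 7 * (648 * (t * √t)) := by
    refine mul_le_mul (by linarith [Real.pi_lt_d2]) (h3.trans (by linarith))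
      (Real.exp_pos _).le (by norm_num)
  linarith

lemma norm_exp_sub_exp_le {z w : ℂ} {r : ℝ} (hz : z.re ≤ r) (hw : w.re ≤ r) :
    ‖Complex.exp z - Complex.exp w‖ ≤ Real.exp r * ‖z - w‖ := by
  refine (convex_halfSpace_re_le r).norm_image_sub_le_of_norm_hasDerivWithin_le
    (f := Complex.exp) (f' := Complex.exp) (fun x _ => (Complex.hasDerivAt_exp x).hasDerivWithinAt)
    (fun x hx => ?_) hw hz
  rw [Complex.norm_exp]
  exact Real.exp_le_exp.2 hx

/-- Half of the Gaussian exponent is spent on absorbing the polynomial. -/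
lemma poly_mul_exp_neg_le (x : ℝ) :
    (428 * x ^ 3 + 2 * x) * Real.exp (-(x ^ 2 / 18)) ≤ 1200000 * Real.exp (-(x ^ 2 / 36)) := by
  have h1 : Real.exp (-(x ^ 2 / 18)) = Real.exp (-(x ^ 2 / 36)) * Real.exp (-(x ^ 2 / 36)) := by
    rw [← Real.exp_add]; congr 1; ring
  have h2 := Real.quadratic_le_exp_of_nonneg (show 0 ≤ x ^ 2 / 36 by positivity)
  have h3 : Real.exp (x ^ 2 / 36) * Real.exp (-(x ^ 2 / 36)) = 1 := by
    rw [← Real.exp_add]; simp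
  have h4 : 428 * x ^ 3 + 2 * x ≤ 1200000 * Real.exp (x ^ 2 / 36) := by
    refine le_trans ?_ (mul_le_mul_of_nonneg_left h2 (by norm_num))
    nlinarith [sq_nonneg (x - 1), sq_nonneg (x ^ 2 - x), sq_nonneg (x ^ 2 - 1), sq_nonneg x]
  rw [h1, ← mul_assoc]
  refine mul_le_mul_of_nonneg_right ?_ (Real.exp_pos _).le
  calc _ ≤ 1200000 * Real.exp (x ^ 2 / 36) * Real.exp (-(x ^ 2 / 36)) := by gcongr
    _ = _ := by rw [mul_assoc, h3, mul_one]

lemma taylorError_mul_exp_le {t : ℝ} (ht : 0 < t) (θ : ℝ) :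
    (428 * |θ| ^ 3 / t ^ 4 + 2 / t * |θ|) * Real.exp (-(θ ^ 2 / (18 * t ^ 3))) ≤
      1200000 * √t * Real.exp (-(θ ^ 2 / (36 * t ^ 3))) := by
  obtain ⟨s, hs, rfl⟩ : ∃ s : ℝ, 0 < s ∧ t = s ^ 2 :=
    ⟨√t, Real.sqrt_pos.2 ht, (Real.sq_sqrt ht.le).symm⟩
  -- In the scale x = |θ|/t^{3/2} both errors gain a factor √t: |θ|³/t⁴ = √t x³ and |θ|/t = √t x.
  have h := mul_le_mul_of_nonneg_left
    (poly_mul_exp_neg_le (|θ| / s ^ 3)) hs.le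
  rw [Real.sqrt_sq hs.le]
  have h1 : (|θ| / s ^ 3) ^ 2 / 18 = θ ^ 2 / (18 * (s ^ 2) ^ 3) := by
    rw [div_pow, sq_abs]; field_simp
  have h2 : (|θ| / s ^ 3) ^ 2 / 36 = θ ^ 2 / (36 * (s ^ 2) ^ 3) := by
    rw [div_pow, sq_abs]; field_simp
  rw [h1, h2, ← mul_assoc] at h
  refine le_trans (le_of_eq ?_) (h.trans (le_of_eq (by ring)))
  congr 1
  field_simp

lemma norm_jumpChar_mul_exp_sub_le {t θ : ℝ} {n : ℕ} (ht : 0 < t) (ht1 : t ≤ 1)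
    (hn : Real.pi ^ 2 / (6 * t ^ 2) = n) (hθ : |θ| ≤ t) :
    ‖jumpChar t θ * Complex.exp (-(n * θ : ℝ) * Complex.I) -
        (Real.exp (-(θ ^ 2 / 2 * jumpVar t)) : ℝ)‖ ≤
      1200000 * √t * Real.exp (-(θ ^ 2 / (36 * t ^ 3))) := by
  have hnorm := norm_jumpChar_le_of_le ht ht1 hθ
  rw [norm_jumpChar ht, Real.exp_le_exp] at hnorm
  have hvar := tsum_jumpRate_mul_one_sub_cos_le ht θ
  have hre := re_tsum_jumpRate_mul_exp_sub_one ht θ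
  have htay := norm_tsum_sub_taylor_le ht θ
  rw [jumpChar, ← Complex.exp_add, Complex.ofReal_exp]
  set S := ∑' p, (jumpRate t p : ℂ) * (Complex.exp ((jumpSize p * θ : ℝ) * Complex.I) - 1)
  have hI : ∀ x : ℝ, (-(x : ℂ) * Complex.I).re = 0 := fun x => by simp
  refine (norm_exp_sub_exp_le (r := -(θ ^ 2 / (18 * t ^ 3))) ?_ ?_).trans ?_
  · rw [Complex.add_re, hre, hI, add_zero]
    exact hnorm
  -- The Gaussian exponent θ²/2 · `jumpVar t` dominates ∑ rate · (1 - cos), so it inherits the lower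
  -- bound θ²/(18t³) without a separate variance estimate.
  · rw [Complex.ofReal_re]
    linarith
  · refine le_trans ?_ (taylorError_mul_exp_le ht θ)
    rw [mul_comm]
    refine mul_le_mul_of_nonneg_right ?_ (Real.exp_pos _).le
    have hmean : ‖(((jumpMean t - n) * θ : ℝ) : ℂ) * Complex.I‖ ≤ 2 / t * |θ| := by
      rw [norm_mul, Complex.norm_I, mul_one, Complex.norm_real, Real.norm_eq_abs, abs_mul, ← hn]
      exact mul_le_mul_of_nonneg_right (abs_jumpMean_sub_le ht ht1) (abs_nonneg θ)
    refine le_trans (le_of_eq ?_) ((norm_add_le _ _).trans (add_le_add htay hmean))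
    congr 1
    push_cast
    ring

lemma le_re_jumpChar_mul_exp {t θ : ℝ} {n : ℕ} (ht : 0 < t) (ht1 : t ≤ 1)
    (hn : Real.pi ^ 2 / (6 * t ^ 2) = n) (hθ : |θ| ≤ Real.pi) :
    Real.exp (-(θ ^ 2 / (t ^ 3 / 7))) - 1200000 * √t * Real.exp (-(θ ^ 2 / (36 * t ^ 3))) -
        2 * Real.exp (-(1 / (18 * t))) ≤
      (jumpChar t θ * Complex.exp (-(n * θ : ℝ) * Complex.I)).re := by
  have hpos := Real.exp_pos (-(1 / (18 * t)))
  rcases le_total |θ| t with h | h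
  · have h1 := (Complex.abs_re_le_norm _).trans (norm_jumpChar_mul_exp_sub_le ht ht1 hn h)
    rw [Complex.sub_re, Complex.ofReal_re] at h1
    have h2 : Real.exp (-(θ ^ 2 / (t ^ 3 / 7))) ≤ Real.exp (-(θ ^ 2 / 2 * jumpVar t)) := by
      rw [Real.exp_le_exp, neg_le_neg_iff]
      calc θ ^ 2 / 2 * jumpVar t ≤ θ ^ 2 / 2 * (14 / t ^ 3) := by
            gcongr; exact jumpVar_le ht
        _ = _ := by field_simp; ring
    linarith [(abs_le.1 h1).1]
  · have h1 := (Complex.abs_re_le_norm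
      (jumpChar t θ * Complex.exp (-(n * θ : ℝ) * Complex.I)))
    rw [norm_mul, norm_exp_neg_ofReal_mul_I, mul_one] at h1
    have h2 := h1.trans (norm_jumpChar_le_of_ge ht ht1 h hθ)
    -- Away from the centre the main Gaussian is itself below the tail bound; hence the factor 2 on
    -- that error.
    have h3 : Real.exp (-(θ ^ 2 / (t ^ 3 / 7))) ≤ Real.exp (-(1 / (18 * t))) := by
      rw [Real.exp_le_exp, neg_le_neg_iff, div_le_div_iff₀ (by positivity) (by positivity)]
      have : t ^ 2 ≤ θ ^ 2 := by rw [← sq_abs θ]; gcongr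
      nlinarith [mul_le_mul_of_nonneg_right this ht.le, pow_pos ht 3]
    have h4 : 0 ≤ 1200000 * √t * Real.exp (-(θ ^ 2 / (36 * t ^ 3))) := by positivity
    linarith [(abs_le.1 h2).1]

/-- On |θ| ≤ t^{3/2} the exponent is at least -7. -/
lemma le_integral_exp_neg_sq_div {t : ℝ} (ht : 0 < t) (ht1 : t ≤ 1) :
    2 * (t * √t) * Real.exp (-7) ≤
      ∫ θ in (-Real.pi)..Real.pi, Real.exp (-(θ ^ 2 / (t ^ 3 / 7))) := by
  have hs : √t ≤ 1 := Real.sqrt_le_one.2 ht1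
  have hr0 : 0 ≤ t * √t := by positivity
  have hr1 : t * √t ≤ Real.pi :=
    (mul_le_one₀ ht1 (Real.sqrt_nonneg t) hs).trans (by linarith [Real.pi_gt_three])
  have hr2 : (t * √t) ^ 2 = t ^ 3 := by
    rw [mul_pow, Real.sq_sqrt ht.le]; ring
  have hcont : Continuous fun θ : ℝ => Real.exp (-(θ ^ 2 / (t ^ 3 / 7))) := by fun_prop
  calc 2 * (t * √t) * Real.exp (-7) = ∫ _ in (-(t * √t))..(t * √t), Real.exp (-7) := by
        rw [intervalIntegral.integral_const, smul_eq_mul]; ring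
    _ ≤ ∫ θ in (-(t * √t))..(t * √t), Real.exp (-(θ ^ 2 / (t ^ 3 / 7))) := by
        refine intervalIntegral.integral_mono_on (by linarith) intervalIntegrable_const
          (hcont.intervalIntegrable _ _) fun θ hθ => ?_
        rw [Real.exp_le_exp, neg_le_neg_iff, div_le_iff₀ (by positivity)]
        have : θ ^ 2 ≤ (t * √t) ^ 2 := sq_le_sq' hθ.1 hθ.2
        linarith
    _ ≤ _ := intervalIntegral.integral_mono_interval (by linarith) (by linarith) hr1
        (Eventually.of_forall fun _ => (Real.exp_pos _).le) (hcont.intervalIntegrable _ _)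

lemma le_re_integral_jumpChar {t : ℝ} {n : ℕ} (ht : 0 < t) (ht1 : t ≤ 1)
    (hn : Real.pi ^ 2 / (6 * t ^ 2) = n) :
    (2 * Real.exp (-7) - 14000000 * √t) * (t * √t) ≤
      (∫ θ in (-Real.pi)..Real.pi, jumpChar t θ * Complex.exp (-(n * θ : ℝ) * Complex.I)).re := by
  have hpi := Real.pi_pos
  have hcont : Continuous fun θ : ℝ => jumpChar t θ * Complex.exp (-(n * θ : ℝ) * Complex.I) :=
    (continuous_jumpChar ht).mul (by fun_prop)
  have hre : (∫ θ in (-Real.pi)..Real.pi,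
      jumpChar t θ * Complex.exp (-(n * θ : ℝ) * Complex.I)).re =
      ∫ θ in (-Real.pi)..Real.pi,
        (jumpChar t θ * Complex.exp (-(n * θ : ℝ) * Complex.I)).re :=
    (Complex.reCLM.intervalIntegral_comp_comm (hcont.intervalIntegrable _ _)).symm
  rw [hre]
  have hi1 : IntervalIntegrable (fun θ : ℝ => Real.exp (-(θ ^ 2 / (t ^ 3 / 7)))) volume
    (-Real.pi) Real.pi := Continuous.intervalIntegrable (by fun_prop) _ _
  have hi2 : IntervalIntegrable (fun θ : ℝ => 1200000 * √t * Real.exp (-(θ ^ 2 / (36 * t ^ 3))))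
    volume (-Real.pi) Real.pi := Continuous.intervalIntegrable (by fun_prop) _ _
  have h := intervalIntegral.integral_mono_on (μ := volume) (a := -Real.pi) (b := Real.pi)
    (f := fun θ => Real.exp (-(θ ^ 2 / (t ^ 3 / 7))) -
      1200000 * √t * Real.exp (-(θ ^ 2 / (36 * t ^ 3))) - 2 * Real.exp (-(1 / (18 * t))))
    (g := fun θ => (jumpChar t θ * Complex.exp (-(n * θ : ℝ) * Complex.I)).re)
    (by linarith) ((hi1.sub hi2).sub intervalIntegrable_const)
    ((Complex.continuous_re.comp hcont).intervalIntegrable _ _)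
    (fun θ hθ => le_re_jumpChar_mul_exp ht ht1 hn (abs_le.2 hθ))
  refine le_trans ?_ h
  rw [intervalIntegral.integral_sub (hi1.sub hi2) intervalIntegrable_const,
    intervalIntegral.integral_sub hi1 hi2, intervalIntegral.integral_const_mul,
    intervalIntegral.integral_const, smul_eq_mul]
  have h1 := le_integral_exp_neg_sq_div ht ht1
  have h2 := (integral_exp_neg_sq_div_le (b := 36 * t ^ 3) (by positivity)).trans
    (sqrt_pi_mul_le (B := 11) ht (by norm_num) (by linarith [Real.pi_lt_d2]))
  have h3 := exp_neg_one_div_le ht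
  have h4 := mul_le_mul_of_nonneg_left h2 (show 0 ≤ 1200000 * √t by positivity)
  have h5 : (Real.pi - -Real.pi) * (2 * Real.exp (-(1 / (18 * t)))) ≤
      7 * (2 * (648 * (√t * (t * √t)))) :=
    mul_le_mul (by linarith [Real.pi_lt_d2]) (by linarith) (by positivity) (by norm_num)
  have h6 : 0 ≤ √t * (t * √t) := by positivity
  linarith

end LocalLimit

/-! ### Comparing p(n - k) with p(n) -/

/-- Up to a constant, `p (n - k)` is at most `p n * exp (-π k / √(6 n))`. -/
def ShiftBound (D : ℝ) (n k : ℕ) : Prop :=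
  (numPartitions (n - k) : ℝ) ≤ D * Real.exp (-(Real.pi / √(6 * n) * k)) * numPartitions n

lemma numPartitions_pos (n : ℕ) : 0 < numPartitions n := by
  rw [numPartitions, Nat.card_eq_fintype_card]
  exact Fintype.card_pos

/-- This fixes the choice of t: the leading term of the mean is exactly n. -/
lemma pi_sq_div_criticalRate {n : ℕ} (hn : 0 < n) :
    Real.pi ^ 2 / (6 * (Real.pi / √(6 * n)) ^ 2) = n := by
  have h : (0 : ℝ) < n := by exact_mod_cast hn
  rw [div_pow, Real.sq_sqrt (by positivity)]
  field_simp

lemma shiftBound_of_rate_le {n k : ℕ} (hn : 0 < n) (hk : k ≤ n)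
    (h1 : Real.pi / √(6 * n) ≤ 1)
    (h2 : 14000000 * √(Real.pi / √(6 * n)) ≤ Real.exp (-7)) :
    ShiftBound (5000 * Real.exp 7) n k := by
  have hn' : (0 : ℝ) < n := by exact_mod_cast hn
  have hpi := Real.pi_pos
  have hcrit := pi_sq_div_criticalRate hn
  rw [ShiftBound]
  have ht : 0 < Real.pi / √(6 * n) := by positivity
  set t := Real.pi / √(6 * n)
  set Z := Real.exp (∑' p, jumpRate t p) with hZ
  have hZ0 : 0 < Z := Real.exp_pos _
  have hI : ∀ m : ℕ, (2 * Real.pi * (numPartitions m * Real.exp (-(t * m))) : ℝ) =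
      Z * (∫ θ in (-Real.pi)..Real.pi,
        jumpChar t θ * Complex.exp (-(m * θ : ℝ) * Complex.I)).re := by
    intro m
    have h := congrArg Complex.re (integral_jumpChar ht m)
    rw [Complex.re_ofReal_mul] at h
    rw [hZ, h, ← Complex.ofReal_ofNat, ← Complex.ofReal_mul, ← Complex.ofReal_mul,
      Complex.ofReal_re]
  have hup : 2 * Real.pi * (numPartitions (n - k) * Real.exp (-(t * (n - k : ℕ)))) ≤
      Z * (5000 * (t * √t)) := by
    rw [hI]
    exact mul_le_mul_of_nonneg_left ((Complex.re_le_norm _).trans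
      (norm_integral_jumpChar_le ht h1 _)) hZ0.le
  have hlow : Z * (Real.exp (-7) * (t * √t)) ≤
      2 * Real.pi * (numPartitions n * Real.exp (-(t * n))) := by
    rw [hI]
    refine mul_le_mul_of_nonneg_left (le_trans ?_ (le_re_integral_jumpChar ht h1 hcrit)) hZ0.le
    exact mul_le_mul_of_nonneg_right (by linarith) (by positivity)
  have h7 : Real.exp 7 * Real.exp (-7) = 1 := by rw [← Real.exp_add]; simp
  have hmain : 2 * Real.pi * (numPartitions (n - k) * Real.exp (-(t * (n - k : ℕ)))) ≤
      5000 * Real.exp 7 * (2 * Real.pi * (numPartitions n * Real.exp (-(t * n)))) := by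
    refine hup.trans (le_trans (le_of_eq ?_)
      (mul_le_mul_of_nonneg_left hlow (show 0 ≤ 5000 * Real.exp 7 by positivity)))
    linear_combination (-(5000 * Z * (t * √t))) * h7
  -- The partition function has cancelled; the mismatch of the weights at n and n - k is the desired
  -- decay factor.
  have he : Real.exp (-(t * n)) = Real.exp (-(t * (n - k : ℕ))) * Real.exp (-(t * k)) := by
    rw [← Real.exp_add, Nat.cast_sub hk]
    congr 1
    ring
  rw [he] at hmain
  refine le_of_mul_le_mul_left ?_
    (show 0 < 2 * Real.pi * Real.exp (-(t * (n - k : ℕ))) by positivity)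
  linarith

/-- For the finitely many n below the threshold, e^{π n₀} outweighs the decay factor and the sum of
all p(m) with m ≤ n₀ bounds p(n - k). -/
lemma shiftBound_of_le {n k n₀ : ℕ} (hn : 0 < n) (hk : k ≤ n) (h : n ≤ n₀) :
    ShiftBound ((∑ m ∈ range (n₀ + 1), numPartitions m : ℕ) * Real.exp (Real.pi * n₀)) n k := by
  have hpi := Real.pi_pos
  have hn1 : (1 : ℝ) ≤ n := by exact_mod_cast hn
  have hp1 : (1 : ℝ) ≤ numPartitions n := by exact_mod_cast numPartitions_pos n
  have h1 : (numPartitions (n - k) : ℝ) ≤ (∑ m ∈ range (n₀ + 1), numPartitions m : ℕ) := by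
    exact_mod_cast single_le_sum (f := numPartitions) (fun _ _ => Nat.zero_le _)
      (mem_range.2 (show n - k < n₀ + 1 by omega))
  have h2 : Real.pi / √(6 * n) * k ≤ Real.pi * n₀ := by
    refine mul_le_mul (div_le_self hpi.le (Real.one_le_sqrt.2 (by linarith))) ?_
      (Nat.cast_nonneg _) hpi.le
    exact_mod_cast hk.trans h
  have h3 : 1 ≤ Real.exp (Real.pi * n₀) * Real.exp (-(Real.pi / √(6 * n) * k)) := by
    rw [← Real.exp_add]
    exact Real.one_le_exp (by linarith)
  rw [ShiftBound, mul_assoc, mul_assoc]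
  refine h1.trans (le_mul_of_one_le_right (Nat.cast_nonneg _) ?_)
  rw [← mul_assoc]
  exact one_le_mul_of_one_le_of_one_le h3 hp1

lemma ShiftBound.mono {D D' : ℝ} {n k : ℕ} (h : ShiftBound D n k) (hD : D ≤ D') :
    ShiftBound D' n k :=
  le_trans h (by gcongr)

open Filter Topology in
theorem exists_shiftBound :
    ∃ D : ℝ, 0 < D ∧ ∀ n k : ℕ, 0 < n → k ≤ n → ShiftBound D n k := by
  have hlim : Tendsto (fun n : ℕ => Real.pi / √(6 * n)) atTop (𝓝 0) := by
    refine tendsto_const_nhds.div_atTop (Real.tendsto_sqrt_atTop.comp ?_)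
    exact tendsto_natCast_atTop_atTop.const_mul_atTop (by norm_num)
  have hlim2 : Tendsto (fun n : ℕ => 14000000 * √(Real.pi / √(6 * n))) atTop (𝓝 0) := by
    have := (hlim.sqrt).const_mul 14000000
    rwa [Real.sqrt_zero, mul_zero] at this
  have hev := (hlim.eventually_le_const one_pos).and
    (hlim2.eventually_le_const (Real.exp_pos (-7)))
  obtain ⟨n₀, hn₀⟩ := eventually_atTop.1 hev
  refine ⟨max (5000 * Real.exp 7)
    ((∑ m ∈ range (n₀ + 1), numPartitions m : ℕ) * Real.exp (Real.pi * n₀)),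
    lt_max_of_lt_left (by positivity), fun n k hn hk => ?_⟩
  rcases le_total n₀ n with h | h
  · exact (shiftBound_of_rate_le hn hk (hn₀ n h).1 (hn₀ n h).2).mono (le_max_left _ _)
  · exact (shiftBound_of_le hn hk h).mono (le_max_right _ _)

/-! ### Summing over multiples of k, and the final constants -/

lemma mul_exp_neg_le_of_le {τ x y : ℝ} (hτ : 0 < τ) (hxy : x ≤ y) (h : 1 / 3 ≤ τ * x) :
    y * Real.exp (-(τ * y)) ≤ 4 * (x * Real.exp (-(τ * x))) := by
  have h1 := mul_exp_neg_mul_le (s := τ) (x := y - x) hτ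
  have h2 : Real.exp (-(τ * (y - x))) ≤ 1 :=
    Real.exp_le_one_iff.2 (by nlinarith)
  have hx : 1 / τ ≤ 3 * x := by rw [div_le_iff₀ hτ]; linarith
  have hx0 : 0 < x := by have := one_div_pos.2 hτ; linarith
  have h3 : Real.exp (-(τ * y)) = Real.exp (-(τ * (y - x))) * Real.exp (-(τ * x)) := by
    rw [← Real.exp_add]; congr 1; ring
  -- The function y e^{-τy} need not be decreasing yet at x. Writing y = (y - x) + x, the first
  -- summand contributes at most 1/τ ≤ 3x and the second at most x.
  have h4 : y * Real.exp (-(τ * (y - x))) ≤ 4 * x := by nlinarith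
  rw [h3, ← mul_assoc, ← mul_assoc]
  exact mul_le_mul_of_nonneg_right h4 (Real.exp_pos _).le

lemma sum_exp_neg_le {x : ℝ} (hx : 1 / 3 ≤ x) (N : ℕ) :
    ∑ j ∈ range N, Real.exp (-(x * (j + 1))) ≤ 4 * Real.exp (-x) := by
  have hq : Real.exp (-x) ≤ 3 / 4 := by
    rw [Real.exp_neg, inv_le_comm₀ (Real.exp_pos _) (by norm_num)]
    linarith [Real.add_one_le_exp x]
  have he : ∀ j : ℕ, Real.exp (-(x * (j + 1))) = Real.exp (-x) * Real.exp (-x) ^ j := by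
    intro j
    rw [← Real.exp_nat_mul, ← Real.exp_add]
    congr 1
    ring
  simp only [he, ← mul_sum]
  rw [mul_comm]
  refine mul_le_mul_of_nonneg_right ?_ (Real.exp_pos _).le
  have hs := summable_geometric_of_lt_one (Real.exp_pos (-x)).le (by linarith)
  refine (hs.sum_le_tsum _ fun _ _ => by positivity).trans ?_
  rw [tsum_geometric_of_lt_one (Real.exp_pos _).le (by linarith), inv_le_comm₀ (by linarith) (by norm_num)]
  linarith

lemma one_sub_le_numCores_div {D : ℝ} (hD : 0 < D)
    (hshift : ∀ n k : ℕ, 0 < n → k ≤ n → ShiftBound D n k) {n k : ℕ} (hn : 0 < n) (hk : 0 < k)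
    (hτ : 1 / 3 ≤ Real.pi / √(6 * n) * k) :
    1 - 4 * D * (k * Real.exp (-(Real.pi / √(6 * n) * k))) ≤
      (numCores k n : ℝ) / numPartitions n := by
  have hp : (0 : ℝ) < numPartitions n := by exact_mod_cast numPartitions_pos n
  have h1 : (numPartitions n : ℝ) ≤ numCores k n +
      k * ∑ j ∈ range (n / k), (numPartitions (n - (j + 1) * k) : ℝ) := by
    exact_mod_cast numPartitions_le_numCores_add n k hk
  have h2 : ∑ j ∈ range (n / k), (numPartitions (n - (j + 1) * k) : ℝ) ≤
      D * numPartitions n * ∑ j ∈ range (n / k),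
        Real.exp (-(Real.pi / √(6 * n) * k * (j + 1))) := by
    rw [mul_sum]
    refine sum_le_sum fun j hj => ?_
    have hjk : (j + 1) * k ≤ n :=
      (Nat.mul_le_mul_right k (mem_range.1 hj)).trans (Nat.div_mul_le_self n k)
    refine le_trans (hshift n _ hn hjk) (le_of_eq ?_)
    push_cast
    rw [show Real.pi / √(6 * n) * (((j : ℝ) + 1) * k) = Real.pi / √(6 * n) * k * (j + 1) by ring]
    ring
  have h3 := mul_le_mul_of_nonneg_left (sum_exp_neg_le hτ (n / k))
    (show 0 ≤ D * numPartitions n by positivity)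
  have h4 := mul_le_mul_of_nonneg_left (h2.trans h3) (Nat.cast_nonneg (α := ℝ) k)
  rw [le_div_iff₀ hp]
  linarith

theorem lemma3 :
    ∃ d : ℝ, ∀ (n : ℕ) (c : ℝ) (k : ℕ), 2 ≤ n → Real.sqrt (3 / 2) / Real.pi < c →
      c * Real.sqrt (n : ℝ) * Real.log (n : ℝ) ≤ (k : ℝ) →
      1 - c ^ 4 * d * Real.log (n : ℝ) / (n : ℝ) ^ (c * Real.pi / Real.sqrt 6 - 1 / 2)
        ≤ (numCores k n : ℝ) / (numPartitions n : ℝ) := by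
  obtain ⟨D, hD, hshift⟩ := exists_shiftBound
  -- 432 = 4 · 4 · 27: the geometric sum, the passage from k to c√n log n, and c ≤ 27c⁴.
  refine ⟨432 * D, fun n c k hn hc hk => ?_⟩
  have hpi := Real.pi_pos
  have hn' : (2 : ℝ) ≤ n := by exact_mod_cast hn
  have hn0 : (0 : ℝ) < n := by linarith
  have hlog : 2 / 3 ≤ Real.log n := by
    have := Real.log_le_log (by norm_num) hn'
    linarith [Real.log_two_gt_d9]
  have h6 : 0 < √6 := by positivity
  -- This is the hypothesis on c rewritten. With log n ≥ 2/3 it gives τx ≥ 1/3, and it also gives c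
  -- ≥ 1/3.
  have hcpi : 1 / 2 < c * Real.pi / √6 := by
    rw [div_lt_iff₀ hpi] at hc
    rw [lt_div_iff₀ h6]
    have : √(3 / 2) = 1 / 2 * √6 := by
      rw [Real.sqrt_eq_iff_mul_self_eq (by norm_num) (by positivity)]
      nlinarith [Real.mul_self_sqrt (show (0 : ℝ) ≤ 6 by norm_num)]
    linarith
  have hc0 : 0 < c := lt_trans (by positivity) hc
  have hc2 : 1 / 3 ≤ c := by
    have h2 : 11 / 5 < √6 := by rw [Real.lt_sqrt (by norm_num)]; norm_num
    rw [div_lt_div_iff₀ (by norm_num) h6] at hcpi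
    have := mul_le_mul_of_nonneg_left Real.pi_lt_d2.le hc0.le
    linarith
  have hsn : 0 < √(n : ℝ) := Real.sqrt_pos.2 hn0
  have hx0 : 0 < c * √(n : ℝ) * Real.log n := by positivity
  have hk0 : (0 : ℝ) < k := hx0.trans_le hk
  have hτ : 0 < Real.pi / √(6 * n) := by positivity
  have hτx : Real.pi / √(6 * n) * (c * √(n : ℝ) * Real.log n) =
      c * Real.pi / √6 * Real.log n := by
    rw [Real.sqrt_mul (by norm_num)]
    field_simp
  have hτx3 : 1 / 3 ≤ Real.pi / √(6 * n) * (c * √(n : ℝ) * Real.log n) := by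
    rw [hτx]; nlinarith
  have h1 := one_sub_le_numCores_div hD hshift (by omega) (by exact_mod_cast hk0)
    (hτx3.trans (mul_le_mul_of_nonneg_left hk hτ.le))
  have h2 := mul_exp_neg_le_of_le hτ hk hτx3
  rw [hτx] at h2
  have h3 : √(n : ℝ) * Real.exp (-(c * Real.pi / √6 * Real.log n)) =
      1 / (n : ℝ) ^ (c * Real.pi / √6 - 1 / 2) := by
    rw [Real.sqrt_eq_rpow, mul_comm (c * Real.pi / √6), ← mul_neg, ← Real.rpow_def_of_pos hn0,
      ← Real.rpow_add hn0, one_div ((n : ℝ) ^ _), ← Real.rpow_neg hn0.le]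
    congr 1
    ring
  have hc4 : c ≤ 27 * c ^ 4 := by
    have : (1 / 3) ^ 3 ≤ c ^ 3 := by gcongr
    nlinarith
  have hP : 0 < (n : ℝ) ^ (c * Real.pi / √6 - 1 / 2) := by positivity
  refine le_trans ?_ h1
  have h4 : 4 * (c * √(n : ℝ) * Real.log n * Real.exp (-(c * Real.pi / √6 * Real.log n))) =
      4 * c * Real.log n / (n : ℝ) ^ (c * Real.pi / √6 - 1 / 2) := by
    linear_combination 4 * c * Real.log n * h3
  rw [h4] at h2
  have h5 : 4 * D * (4 * c * Real.log n / (n : ℝ) ^ (c * Real.pi / √6 - 1 / 2)) ≤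
      c ^ 4 * (432 * D) * Real.log n / (n : ℝ) ^ (c * Real.pi / √6 - 1 / 2) := by
    rw [← mul_div_assoc]
    refine div_le_div_of_nonneg_right ?_ hP.le
    nlinarith [mul_le_mul_of_nonneg_left hc4 (show 0 ≤ 16 * D * Real.log n by positivity)]
  have h6 := mul_le_mul_of_nonneg_left h2 (show 0 ≤ 4 * D by positivity)
  linarith
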